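/- Let $M_2$ be the algebra of complex $2\times 2$ matrices and let $\Phi:M_2\to M_2$ be a trace-preserving complex-linear map (a trace-preserving qubit map). A density matrix is a positive semidefinite matrix of trace one. $\Phi$ is completely positive if $I_n\otimes\Phi$ maps positive semidefinite operators on $\mathbb C^n\otimes\mathbb C^2$ to positive semidefinite operators for every $n$. Let $\sigma_1,\sigma_2,\sigma_3$ be the Pauli matrices. For $t,\lambda\in\mathbb R^3$ let $\Phi_{t,\lambda}$ be the linear map on $M_2$ whose matrix in the basis $\{I,\sigma_1,\sigma_2,\sigma_3\}$ is $$\begin{pmatrix}1&0&0&0\\ t_1&\lambda_1&0&0\\ t_2&0&\lambda_2&0\\ t_3&0&0&\lambda_3\end{pmatrix},$$ that is, $\Phi_{t,\lambda}(I)=I+\sum_k t_k\sigma_k$ and $\Phi_{t,\lambda}(\sigma_k)=\lambda_k\sigma_k$. We say that $\Phi_{t,\lambda}$ is a canonical form of $\Phi$ if there are $2\times2$ unitary matrices $U,V$ with $\Phi(\rho)=U\,\Phi_{t,\lambda}(V\rho V^*)\,U^*$ for all $\rho\in M_2$. Then the following are equivalent. (A) $\Phi$ has the Holevo form $\Phi(\rho)=\sum_k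 R_k\,\mathrm{Tr}(F_k\rho)$ (a finite sum), where each $R_k$ is a density matrix and $\{F_k\}$ is a POVM, i.e. each $F_k$ is positive semidefinite and $\sum_k F_k=I$. (B) $\Phi$ is entanglement breaking: for every $n$ and every density matrix $\Gamma$ on $\mathbb C^n\otimes\mathbb C^2$, $(I_n\otimes\Phi)(\Gamma)$ is separable, i.e. a convex combination of tensor products $\sigma\otimes\tau$ of density matrices. (C) $\Phi$ is completely positive and $\Phi\circ T$ is completely positive, where $T(\rho)=\rho^T$ is the transpose. (D) $\Phi$ is completely positive and has the sign-change property: for every canonical form $\Phi_{t,\lambda}$ of $\Phi$ and every $k\in\{1,2,3\}$, replacing $\lambda_k$ by $-\lambda_k$ (with $t$ and the other $\lambda_j$ unchanged) yields a completely positive map. (D$'$) $\Phi$ is completely positive and there is at least one canonical form $\Phi_{t,\lambda}$ of $\Phi$ such that for every $k\in\{1,2,3\}$ replacing $\lambda_k$ by $-\lambda_k$ yields a completely positive map. (E) $\Phi$ lies in the convex hull of the set of CQ maps, where a CQ (classical-quantum) map is a map $\rho\mapsto\sum_k R_k\,\mathrm{Tr}(F_k\rho)$ with density matrices $R_k$ and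 a POVM $\{F_k\}$ each of whose elements is a one-dimensional projection. In particular, if $\Phi$ is completely positive and trace-preserving, then (A), (B), (E), the complete positivity of $\Phi\circ T$, and the sign-change property (for one, equivalently for every, canonical form) are all equivalent. -/

import Mathlib

open scoped Kronecker ComplexOrder

noncomputable section

namespace QubitMap

/-- The algebra of operators on a qubit, i.e. complex `2 × 2` matrices. -/
abbrev M₂ : Type := Matrix (Fin 2) (Fin 2) ℂ

/-- Density matrices: positive semidefinite of trace one. -/
def IsDensity {ι : Type} [Fintype ι] (ρ : Matrix ι ι ℂ) : Prop :=
  ρ.PosSemidef ∧ ρ.trace = 1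

/-- A linear map on qubit operators that preserves the trace. -/
def IsTracePreserving (Φ : M₂ →ₗ[ℂ] M₂) : Prop :=
  ∀ ρ : M₂, (Φ ρ).trace = ρ.trace

/-- The map `I ⊗ Φ` on operators on `ℂⁿ ⊗ ℂ²`: apply `Φ` to each of the `n × n` blocks. -/
def idTensor (n : ℕ) (Φ : M₂ →ₗ[ℂ] M₂)
    (Γ : Matrix (Fin n × Fin 2) (Fin n × Fin 2) ℂ) :
    Matrix (Fin n × Fin 2) (Fin n × Fin 2) ℂ :=
  Matrix.of fun x y => Φ (Matrix.of fun c d => Γ (x.1, c) (y.1, d)) x.2 y.2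

/-- Complete positivity: `I ⊗ Φ` preserves positive semidefiniteness for every ancilla `ℂⁿ`. -/
def IsCP (Φ : M₂ →ₗ[ℂ] M₂) : Prop :=
  ∀ (n : ℕ) (Γ : Matrix (Fin n × Fin 2) (Fin n × Fin 2) ℂ),
    Γ.PosSemidef → (idTensor n Φ Γ).PosSemidef

/-- Separable operators on `ℂⁿ ⊗ ℂ²`: convex combinations of products of density matrices. -/
def IsSeparable (n : ℕ) (Γ : Matrix (Fin n × Fin 2) (Fin n × Fin 2) ℂ) : Prop :=
  Γ ∈ convexHull ℝ
    {γ : Matrix (Fin n × Fin 2) (Fin n × Fin 2) ℂ |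
      ∃ (σ : Matrix (Fin n) (Fin n) ℂ) (τ : M₂), IsDensity σ ∧ IsDensity τ ∧ γ = σ ⊗ₖ τ}

/-- Entanglement breaking: `(I ⊗ Φ)(Γ)` is separable for every density matrix `Γ` on every
tensor product `ℂⁿ ⊗ ℂ²`. -/
def IsEntanglementBreaking (Φ : M₂ →ₗ[ℂ] M₂) : Prop :=
  ∀ (n : ℕ) (Γ : Matrix (Fin n × Fin 2) (Fin n × Fin 2) ℂ),
    IsDensity Γ → IsSeparable n (idTensor n Φ Γ)

/-- A (finite) positive operator valued measure on a qubit. -/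
def IsPOVM {K : ℕ} (F : Fin K → M₂) : Prop :=
  (∀ k, (F k).PosSemidef) ∧ ∑ k, F k = 1

/-- The Holevo form `Φ(ρ) = ∑ₖ Rₖ Tr(Fₖ ρ)` for given `Rₖ` and `Fₖ`. -/
def IsHolevo {K : ℕ} (Φ : M₂ →ₗ[ℂ] M₂) (R F : Fin K → M₂) : Prop :=
  ∀ ρ : M₂, Φ ρ = ∑ k, (F k * ρ).trace • R k

/-- `Φ` has the Holevo form with density matrices `Rₖ` and a POVM `{Fₖ}`. -/
def HasHolevoForm (Φ : M₂ →ₗ[ℂ] M₂) : Prop :=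
  ∃ (K : ℕ) (R F : Fin K → M₂), (∀ k, IsDensity (R k)) ∧ IsPOVM F ∧ IsHolevo Φ R F

/-- One-dimensional projections `|ψ⟩⟨ψ|` with `ψ` a unit vector. -/
def IsRankOneProjection (P : M₂) : Prop :=
  ∃ ψ : Fin 2 → ℂ, star ψ ⬝ᵥ ψ = 1 ∧ P = Matrix.vecMulVec ψ (star ψ)

/-- Classical-quantum (CQ) maps: Holevo form with a POVM consisting of one-dimensional
projections (which are then the projections onto the vectors of an orthonormal basis). -/
def IsCQ (Φ : M₂ →ₗ[ℂ] M₂) : Prop :=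
  ∃ (K : ℕ) (R F : Fin K → M₂), (∀ k, IsDensity (R k)) ∧ IsPOVM F ∧
    (∀ k, IsRankOneProjection (F k)) ∧ IsHolevo Φ R F

/-- The transpose `T(ρ) = ρᵀ`. -/
def transposeMap : M₂ →ₗ[ℂ] M₂ :=
  (Matrix.transposeLinearEquiv (Fin 2) (Fin 2) ℂ ℂ).toLinearMap

/-- The Pauli matrices `σ₁, σ₂, σ₃`. -/
def pauli : Fin 3 → M₂ :=
  ![!![0, 1; 1, 0], !![0, -Complex.I; Complex.I, 0], !![1, 0; 0, -1]]

/-- The map whose matrix in the basis `{I, σ₁, σ₂, σ₃}` has first column `(1, t₁, t₂, t₃)` and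
diagonal `(1, lam₁, lam₂, lam₃)`, all other entries being zero: it sends
`½ (w₀ I + ∑ₖ wₖ σₖ)` to `½ (w₀ I + ∑ₖ (w₀ tₖ + lamₖ wₖ) σₖ)`, where
`w₀ = Tr ρ` and `wₖ = Tr (σₖ ρ)`. -/
def canonicalMap (t lam : Fin 3 → ℝ) : M₂ →ₗ[ℂ] M₂ where
  toFun ρ := (1 / 2 : ℂ) • (ρ.trace • (1 : M₂) +
    ∑ k, (ρ.trace * (t k : ℂ) + (lam k : ℂ) * (pauli k * ρ).trace) • pauli k)
  map_add' ρ ρ' := by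
    simp only [Matrix.mul_add, Matrix.trace_add, Fin.sum_univ_three]
    module
  map_smul' c ρ := by
    simp only [Matrix.mul_smul, Matrix.trace_smul, Fin.sum_univ_three, smul_eq_mul,
      RingHom.id_apply]
    module

/-- `(t, lam)` are parameters of a canonical form of `Φ`: up to unitary changes of basis in the
domain and in the range, `Φ` is the map `canonicalMap t lam`. -/
def IsCanonicalForm (Φ : M₂ →ₗ[ℂ] M₂) (t lam : Fin 3 → ℝ) : Prop :=
  ∃ U ∈ Matrix.unitaryGroup (Fin 2) ℂ, ∃ V ∈ Matrix.unitaryGroup (Fin 2) ℂ,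
    ∀ ρ : M₂, Φ ρ = U * canonicalMap t lam (V * ρ * star V) * star U

/-- Changing any single `lamₖ` to `-lamₖ` (keeping `t` and the others) gives a completely
positive map. -/
def SignChangesCP (t lam : Fin 3 → ℝ) : Prop :=
  ∀ k : Fin 3, IsCP (canonicalMap t (Function.update lam k (-lam k)))

end QubitMap

end

open scoped Kronecker ComplexOrder

noncomputable section

namespace QubitMap

open Matrix

/-! The implications other than (C) to (E) are soft. A Holevo map measures and prepares, so its
output is a sum of products (`HasHolevoForm.isEntanglementBreaking`). Separable operators have
positive partial transpose, which gives (C). Precomposing a canonical form with the transpose flips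
the second parameter, and Pauli conjugations move this flip to any position (`signChangesCP_iff`); a
canonical form exists by the singular value decomposition and the lifting of rotations to unitaries.
Holevo maps form a convex set containing the CQ maps.

For (C) to (E), write `Φ` on the Bloch ball as `w ↦ t + T w`. If `(t, T)` is outside the compact
convex hull of the CQ parameters, Hahn–Banach gives `(c, M)` and a level `u` with `|c + M n| + |c -
M n| < 2u` for every `n` in the ball, while `c · t + ⟨M, T⟩ > u`. These data define a map `W`
(`witness`) whose pairing with `Φ` is negative. One coefficient of `W` does not enter the pairing;
choosing it as `c ᵥ* M / u` makes `W` positive and also makes `W(1)^(-1/2) W(·) W(1)^(-1/2)`, up to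
a unitary, both unital and trace preserving.

Such a map is, up to rotations, diagonal with parameters in the cube `[-1, 1]³`. The vertices of the
cube are Pauli conjugations, possibly composed with the transpose (`canonicalMap_vertex`). Hence `W`
pairs nonnegatively with every `Φ` for which `Φ` and `Φ ∘ T` are completely positive
(`pairing_nonneg_of_unital`), a contradiction (`le_of_forall_blochBall`). -/

/-! ### Conjugations, the transpose and sign changes in canonical forms -/

/-- The conjugation map `ρ ↦ A ρ A*`. -/
def conjMap (A : M₂) : M₂ →ₗ[ℂ] M₂ where
  toFun ρ := A * ρ * Aᴴ
  map_add' ρ ρ' := by simp [Matrix.mul_add, Matrix.add_mul]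
  map_smul' c ρ := by simp

@[simp] lemma conjMap_apply (A ρ : M₂) : conjMap A ρ = A * ρ * Aᴴ := rfl

@[simp] lemma transposeMap_apply (ρ : M₂) : transposeMap ρ = ρᵀ := rfl

lemma isCanonicalForm_iff {Φ : M₂ →ₗ[ℂ] M₂} {t lam : Fin 3 → ℝ} :
    IsCanonicalForm Φ t lam ↔ ∃ U ∈ unitaryGroup (Fin 2) ℂ, ∃ V ∈ unitaryGroup (Fin 2) ℂ,
      Φ = conjMap U ∘ₗ canonicalMap t lam ∘ₗ conjMap V := by
  simp only [IsCanonicalForm, LinearMap.ext_iff, LinearMap.comp_apply, conjMap_apply,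
    star_eq_conjTranspose]

lemma conjMap_comp (A B : M₂) : conjMap A ∘ₗ conjMap B = conjMap (A * B) := by
  ext1 ρ
  simp [Matrix.mul_assoc]

lemma conjMap_one : conjMap 1 = LinearMap.id := by
  ext1 ρ
  simp

lemma transposeMap_comp_conjMap (A : M₂) :
    transposeMap ∘ₗ conjMap A = conjMap (A.map star) ∘ₗ transposeMap := by
  ext1 ρ
  simp only [LinearMap.comp_apply, conjMap_apply, transposeMap_apply, Matrix.transpose_mul,
    Matrix.mul_assoc]
  rw [show (A.map star)ᴴ = Aᵀ by ext; simp]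
  rfl

lemma isCP_comp {Φ Ψ : M₂ →ₗ[ℂ] M₂} (hΦ : IsCP Φ) (hΨ : IsCP Ψ) : IsCP (Φ ∘ₗ Ψ) :=
  fun n Γ hΓ => hΦ n _ (hΨ n Γ hΓ)

lemma idTensor_conjMap (n : ℕ) (A : M₂) (Γ : Matrix (Fin n × Fin 2) (Fin n × Fin 2) ℂ) :
    idTensor n (conjMap A) Γ = ((1 : Matrix (Fin n) (Fin n) ℂ) ⊗ₖ A) * Γ *
      ((1 : Matrix (Fin n) (Fin n) ℂ) ⊗ₖ A)ᴴ := by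
  ext ⟨i, a⟩ ⟨j, b⟩
  simp [idTensor, Matrix.mul_apply, Fintype.sum_prod_type, Matrix.one_apply,
    Fin.sum_univ_two, ite_mul, apply_ite]

lemma isCP_conjMap (A : M₂) : IsCP (conjMap A) := fun n Γ hΓ => by
  rw [idTensor_conjMap]
  exact hΓ.mul_mul_conjTranspose_same _

lemma unitary_conjTranspose_mul {U : M₂} (hU : U ∈ unitaryGroup (Fin 2) ℂ) : Uᴴ * U = 1 :=
  mem_unitaryGroup_iff'.mp hU

lemma unitary_mul_conjTranspose {U : M₂} (hU : U ∈ unitaryGroup (Fin 2) ℂ) : U * Uᴴ = 1 :=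
  mem_unitaryGroup_iff.mp hU

lemma conjMap_conjTranspose_comp {U : M₂} (hU : U ∈ unitaryGroup (Fin 2) ℂ) :
    conjMap Uᴴ ∘ₗ conjMap U = LinearMap.id := by
  rw [conjMap_comp, unitary_conjTranspose_mul hU, conjMap_one]

lemma conjMap_comp_conjTranspose {U : M₂} (hU : U ∈ unitaryGroup (Fin 2) ℂ) :
    conjMap U ∘ₗ conjMap Uᴴ = LinearMap.id := by
  rw [conjMap_comp, unitary_mul_conjTranspose hU, conjMap_one]

/-- Inserting the transpose changes the sign of the middle parameter. -/
lemma canonicalMap_comp_transposeMap (t lam : Fin 3 → ℝ) :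
    canonicalMap t lam ∘ₗ transposeMap = canonicalMap t (Function.update lam 1 (-lam 1)) := by
  ext1 ρ
  simp [canonicalMap, pauli, Fin.sum_univ_three, Matrix.trace_fin_two, Matrix.mul_apply,
    Fin.sum_univ_two]
  ring_nf
  trivial

lemma canonicalMap_comp_conjMap_pauli_zero (t lam : Fin 3 → ℝ) :
    canonicalMap t lam ∘ₗ conjMap (pauli 0) =
      canonicalMap t (Function.update (Function.update lam 1 (-lam 1)) 2 (-lam 2)) := by
  ext1 ρ
  simp [canonicalMap, pauli, Fin.sum_univ_three, Matrix.trace_fin_two, Matrix.mul_apply,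
    Matrix.vecMul, vecHead, vecTail, ← Matrix.ext_iff, Fin.forall_fin_two]
  ring_nf
  simp

lemma canonicalMap_comp_conjMap_pauli_two (t lam : Fin 3 → ℝ) :
    canonicalMap t lam ∘ₗ conjMap (pauli 2) =
      canonicalMap t (Function.update (Function.update lam 0 (-lam 0)) 1 (-lam 1)) := by
  ext1 ρ
  simp [canonicalMap, pauli, Fin.sum_univ_three, Matrix.trace_fin_two, Matrix.mul_apply,
    Matrix.vecMul, vecHead, vecTail]
  ring_nf
  simp

/-- Conjugation by a Pauli matrix in the domain flips two parameters at once and preserves complete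
positivity, so all three single flips are equivalent to the middle one, which is the transpose. -/
lemma signChangesCP_iff (t lam : Fin 3 → ℝ) :
    SignChangesCP t lam ↔ IsCP (canonicalMap t lam ∘ₗ transposeMap) := by
  rw [canonicalMap_comp_transposeMap]
  refine ⟨fun h => h 1, fun h k => ?_⟩
  fin_cases k
  · have := isCP_comp h (isCP_conjMap (pauli 2))
    rw [canonicalMap_comp_conjMap_pauli_two] at this
    convert this using 2
    ext k
    fin_cases k <;> simp
  · exact h
  · have := isCP_comp h (isCP_conjMap (pauli 0))
    rw [canonicalMap_comp_conjMap_pauli_zero] at this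
    convert this using 2
    ext k
    fin_cases k <;> simp

/-- The transpose moves past conjugation by `V` at the price of replacing `V` by its entrywise
conjugate, which is again unitary; the outer unitaries can then be cancelled. -/
lemma IsCanonicalForm.isCP_comp_transposeMap_iff {Φ : M₂ →ₗ[ℂ] M₂} {t lam : Fin 3 → ℝ}
    (h : IsCanonicalForm Φ t lam) : IsCP (Φ ∘ₗ transposeMap) ↔ SignChangesCP t lam := by
  obtain ⟨U, hU, V, hV, rfl⟩ := isCanonicalForm_iff.mp h
  have key : (conjMap U ∘ₗ canonicalMap t lam ∘ₗ conjMap V) ∘ₗ transposeMap =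
      conjMap U ∘ₗ (canonicalMap t lam ∘ₗ transposeMap) ∘ₗ conjMap (V.map star) := by
    have := transposeMap_comp_conjMap (V.map star)
    rw [show (V.map star).map star = V by ext; simp] at this
    simp only [LinearMap.comp_assoc, this]
  have hV' : V.map star ∈ unitaryGroup (Fin 2) ℂ := by
    rw [mem_unitaryGroup_iff', star_eq_conjTranspose,
      show (V.map star)ᴴ = Vᵀ by ext; simp, show V.map star = (Vᴴ)ᵀ from rfl,
      ← Matrix.transpose_mul, unitary_conjTranspose_mul hV, Matrix.transpose_one]
  rw [signChangesCP_iff, key]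
  refine ⟨fun h => ?_, fun h => isCP_comp (isCP_conjMap _) (isCP_comp h (isCP_conjMap _))⟩
  have h' := isCP_comp (isCP_conjMap Uᴴ) (isCP_comp h (isCP_conjMap (V.map star)ᴴ))
  rwa [LinearMap.comp_assoc, ← LinearMap.comp_assoc, conjMap_conjTranspose_comp hU,
    LinearMap.comp_assoc, conjMap_comp_conjTranspose hV', LinearMap.comp_id,
    LinearMap.id_comp] at h'

/-! ### Holevo form, entanglement breaking, positive partial transpose -/

/-- The transpose of the first tensor factor. -/
def partialTranspose {n : ℕ} (Γ : Matrix (Fin n × Fin 2) (Fin n × Fin 2) ℂ) :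
    Matrix (Fin n × Fin 2) (Fin n × Fin 2) ℂ :=
  Matrix.of fun x y => Γ (y.1, x.2) (x.1, y.2)

lemma convex_posSemidef (ι : Type) [Fintype ι] :
    Convex ℝ {A : Matrix ι ι ℂ | A.PosSemidef} := by
  intro A hA B hB a b ha hb _
  exact (hA.smul ha).add (hB.smul hb)

lemma IsSeparable.posSemidef {n : ℕ} {Γ : Matrix (Fin n × Fin 2) (Fin n × Fin 2) ℂ}
    (h : IsSeparable n Γ) : Γ.PosSemidef := by
  refine convexHull_min ?_ (convex_posSemidef _) h
  rintro _ ⟨σ, τ, hσ, hτ, rfl⟩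
  exact hσ.1.kronecker hτ.1

/-- The Peres criterion: on a product the partial transpose only replaces the first factor by its
transpose, and positivity survives convex combinations. -/
lemma IsSeparable.posSemidef_partialTranspose {n : ℕ}
    {Γ : Matrix (Fin n × Fin 2) (Fin n × Fin 2) ℂ} (h : IsSeparable n Γ) :
    (partialTranspose Γ).PosSemidef := by
  have hc : Convex ℝ {Γ : Matrix (Fin n × Fin 2) (Fin n × Fin 2) ℂ |
      (partialTranspose Γ).PosSemidef} := by
    intro A hA B hB a b ha hb _
    exact (Matrix.PosSemidef.smul hA ha).add (Matrix.PosSemidef.smul hB hb)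
  refine convexHull_min ?_ hc h
  rintro _ ⟨σ, τ, hσ, hτ, rfl⟩
  exact hσ.1.transpose.kronecker hτ.1

lemma idTensor_smul (n : ℕ) (Φ : M₂ →ₗ[ℂ] M₂) (c : ℂ)
    (Γ : Matrix (Fin n × Fin 2) (Fin n × Fin 2) ℂ) :
    idTensor n Φ (c • Γ) = c • idTensor n Φ Γ := by
  ext x y
  exact congrFun₂ (Φ.map_smul c (Matrix.of fun c' d => Γ (x.1, c') (y.1, d))) x.2 y.2

lemma exists_isDensity_smul {ι : Type} [Fintype ι] {A : Matrix ι ι ℂ} (hA : A.PosSemidef) :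
    A = 0 ∨ ∃ r : ℝ, 0 < r ∧ A.trace = r ∧ ∃ ρ : Matrix ι ι ℂ, IsDensity ρ ∧ A = (r : ℂ) • ρ := by
  obtain h | h := eq_or_ne A 0
  · exact .inl h
  right
  have h0 : 0 ≤ A.trace := hA.trace_nonneg
  have h1 : A.trace ≠ 0 := fun h' => h (hA.trace_eq_zero_iff.mp h')
  obtain ⟨hre, him⟩ := Complex.le_def.mp h0
  have htr : A.trace = (A.trace.re : ℂ) := Complex.ext (by simp) (by simpa using him.symm)
  have hr : 0 < A.trace.re := lt_of_le_of_ne (by simpa using hre) fun h' => h1 (by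
    rw [htr, ← h']; simp)
  refine ⟨A.trace.re, hr, htr, ((A.trace.re : ℂ)⁻¹) • A, ⟨hA.smul ?_, ?_⟩, ?_⟩
  · rw [← Complex.ofReal_inv]
    exact_mod_cast (inv_pos.mpr hr).le
  · rw [Matrix.trace_smul, ← htr, smul_eq_mul, inv_mul_cancel₀ h1]
  · rw [smul_smul, mul_inv_cancel₀ (by exact_mod_cast hr.ne'), one_smul]

lemma IsEntanglementBreaking.isCP {Φ : M₂ →ₗ[ℂ] M₂} (h : IsEntanglementBreaking Φ) :
    IsCP Φ ∧ IsCP (Φ ∘ₗ transposeMap) := by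
  have key : ∀ (n : ℕ) (Γ : Matrix (Fin n × Fin 2) (Fin n × Fin 2) ℂ), Γ.PosSemidef →
      (idTensor n Φ Γ).PosSemidef ∧ (partialTranspose (idTensor n Φ Γ)).PosSemidef := by
    intro n Γ hΓ
    obtain rfl | ⟨r, hr, -, ρ, hρ, rfl⟩ := exists_isDensity_smul hΓ
    · have h0 : idTensor n Φ 0 = 0 := by
        simpa using idTensor_smul n Φ 0 0
      rw [h0]
      exact ⟨.zero, (.zero : (0 : Matrix (Fin n × Fin 2) (Fin n × Fin 2) ℂ).PosSemidef)⟩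
    · have hr' : (0 : ℂ) ≤ r := by exact_mod_cast hr.le
      rw [idTensor_smul]
      exact ⟨(h n ρ hρ).posSemidef.smul hr',
        (h n ρ hρ).posSemidef_partialTranspose.smul hr'⟩
  -- Transposing all of `Γ` and then the ancilla again leaves only the transpose on the qubit, so
  -- the second component unfolds to `I ⊗ (Φ ∘ T)`.
  exact ⟨fun n Γ hΓ => (key n Γ hΓ).1, fun n Γ hΓ => (key n Γᵀ hΓ.transpose).2⟩

lemma isSeparable_of_sum {n K : ℕ} (A : Fin K → Matrix (Fin n) (Fin n) ℂ) (R : Fin K → M₂)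
    (hA : ∀ k, (A k).PosSemidef) (htr : ∑ k, (A k).trace = 1) (hR : ∀ k, IsDensity (R k)) :
    IsSeparable n (∑ k, A k ⊗ₖ R k) := by
  have hz : ∀ k, ∃ σ : Matrix (Fin n) (Fin n) ℂ, A k ≠ 0 →
      IsDensity σ ∧ 0 < (A k).trace.re ∧ A k = (A k).trace.re • σ := by
    intro k
    obtain h | ⟨r, hr, htr, ρ, hρ, h⟩ := exists_isDensity_smul (hA k)
    · exact ⟨0, fun h' => absurd h h'⟩
    · refine ⟨ρ, fun _ => ⟨hρ, ?_, ?_⟩⟩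
      · simpa [htr] using hr
      · rw [htr, Complex.ofReal_re, ← Complex.coe_smul]
        exact h
  choose σ hσ using hz
  classical
  have hsum : ∑ k, A k ⊗ₖ R k = ∑ k with A k ≠ 0, (A k).trace.re • (σ k ⊗ₖ R k) := by
    rw [Finset.sum_filter]
    refine Finset.sum_congr rfl fun k _ => ?_
    split_ifs with h
    · conv_lhs => rw [(hσ k h).2.2]
      rw [Matrix.smul_kronecker]
    · rw [not_not.mp h, Matrix.zero_kronecker]
  rw [hsum]
  refine (convex_convexHull ℝ _).sum_mem (fun k hk => ?_) ?_ fun k hk => ?_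
  · exact (hσ k (Finset.mem_filter.mp hk).2).2.1.le
  · rw [Finset.sum_filter]
    have : ∑ k, (A k).trace.re = 1 := by
      rw [← Complex.re_sum, htr, Complex.one_re]
    rw [← this]
    refine Finset.sum_congr rfl fun k _ => ?_
    split_ifs with h
    · rfl
    · simp [not_not.mp h]
  · exact subset_convexHull ℝ _ ⟨σ k, R k, (hσ k (Finset.mem_filter.mp hk).2).1, hR k, rfl⟩

lemma HasHolevoForm.isEntanglementBreaking {Φ : M₂ →ₗ[ℂ] M₂} (h : HasHolevoForm Φ) :
    IsEntanglementBreaking Φ := by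
  obtain ⟨K, R, F, hR, ⟨hF, hsum⟩, hΦ⟩ := h
  intro n Γ hΓ
  -- The partial trace over the qubit of `(1 ⊗ F k) Γ`: the unnormalised ancilla state after outcome
  -- `k`.
  let A : Fin K → Matrix (Fin n) (Fin n) ℂ := fun k =>
    Matrix.of fun i j => (F k * Matrix.of fun c d => Γ (i, c) (j, d)).trace
  have hid : idTensor n Φ Γ = ∑ k, A k ⊗ₖ R k := by
    ext x y
    simp only [idTensor, Matrix.of_apply, hΦ _, Matrix.sum_apply, Matrix.smul_apply, smul_eq_mul,
      kroneckerMap_apply, A]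
  rw [hid]
  refine isSeparable_of_sum A R (fun k => ?_) ?_ hR
  · obtain ⟨m, v, hv⟩ := Matrix.posSemidef_iff_eq_sum_vecMulVec.mp (hF k)
    -- `B l` is `1 ⊗ ⟨v l|`, so a decomposition of `F k` into rank-one terms writes `A k` as a sum
    -- of congruences of `Γ`.
    let B : Fin m → Matrix (Fin n) (Fin n × Fin 2) ℂ := fun l =>
      Matrix.of fun i x => if i = x.1 then star (v l x.2) else 0
    have hAk : A k = ∑ l, B l * Γ * (B l)ᴴ := by
      ext i j
      simp only [A, hv, Matrix.of_apply, Finset.sum_mul, Matrix.trace_sum, Matrix.sum_apply]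
      refine Finset.sum_congr rfl fun l _ => ?_
      simp [B, Matrix.trace_fin_two, Matrix.mul_apply, Fintype.sum_prod_type, Fin.sum_univ_two,
        Matrix.vecMulVec_apply, apply_ite, ite_mul]
      ring
    rw [hAk]
    exact Matrix.posSemidef_sum _ fun l _ => hΓ.1.mul_mul_conjTranspose_same _
  · calc ∑ k, (A k).trace
        = ∑ i, ((∑ k, F k) * Matrix.of fun c d => Γ (i, c) (i, d)).trace := by
          simp only [Finset.sum_mul, Matrix.trace_sum]
          rw [Finset.sum_comm]
          rfl
      _ = 1 := by
          rw [hsum, ← hΓ.2]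
          simp [Matrix.trace, Fintype.sum_prod_type]

/-- A mixture is realised by a single measurement with the disjoint union of outcomes, the weights
being absorbed into the POVM. -/
lemma convex_hasHolevoForm : Convex ℝ {Φ : M₂ →ₗ[ℂ] M₂ | HasHolevoForm Φ} := by
  rintro Φ ⟨K, R, F, hR, ⟨hF, hsum⟩, hΦ⟩ Ψ ⟨L, S, G, hS, ⟨hG, hsum'⟩, hΨ⟩ a b ha hb hab
  refine ⟨K + L, Fin.append R S, Fin.append (fun k => a • F k) (fun k => b • G k),
    ?_, ⟨?_, ?_⟩, ?_⟩
  · intro k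
    refine Fin.addCases (fun k => ?_) (fun k => ?_) k <;> simp [hR, hS]
  · intro k
    refine Fin.addCases (fun k => ?_) (fun k => ?_) k
    · simpa using (hF k).smul ha
    · simpa using (hG k).smul hb
  · simp [Fin.sum_univ_add, ← Finset.smul_sum, hsum, hsum', ← add_smul, hab]
  · intro ρ
    simp [Fin.sum_univ_add, hΦ ρ, hΨ ρ, Finset.smul_sum, mul_smul]

lemma hasHolevoForm_of_mem_convexHull {Φ : M₂ →ₗ[ℂ] M₂}
    (h : Φ ∈ convexHull ℝ {Ψ : M₂ →ₗ[ℂ] M₂ | IsCQ Ψ}) : HasHolevoForm Φ := by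
  refine convexHull_min ?_ convex_hasHolevoForm h
  rintro Ψ ⟨K, R, F, hR, hF, -, hΨ⟩
  exact ⟨K, R, F, hR, hF, hΨ⟩

/-! ### Pauli coordinates -/

/-- The Hermitian traceless matrix `∑ₖ vₖ σₖ`. -/
def pauliVec (v : Fin 3 → ℝ) : M₂ := ∑ k, (v k : ℂ) • pauli k

lemma pauliVec_eq (v : Fin 3 → ℝ) : pauliVec v =
    !![(v 2 : ℂ), v 0 - Complex.I * v 1; v 0 + Complex.I * v 1, -(v 2 : ℂ)] := by
  ext i j
  fin_cases i <;> fin_cases j <;> simp [pauliVec, pauli, Fin.sum_univ_three] <;> ring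

lemma pauliVec_single (k : Fin 3) : pauliVec (Pi.single k 1) = pauli k := by
  simp [pauliVec, Pi.single_apply]

@[simp] lemma pauliVec_zero : pauliVec 0 = 0 := by simp [pauliVec]

lemma pauliVec_neg (v : Fin 3 → ℝ) : pauliVec (-v) = -pauliVec v := by simp [pauliVec]

lemma pauliVec_add (v w : Fin 3 → ℝ) : pauliVec (v + w) = pauliVec v + pauliVec w := by
  simp [pauliVec, add_smul, Finset.sum_add_distrib]

lemma pauliVec_sub (v w : Fin 3 → ℝ) : pauliVec (v - w) = pauliVec v - pauliVec w := by
  rw [sub_eq_add_neg, pauliVec_add, pauliVec_neg, ← sub_eq_add_neg]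

lemma pauliVec_smul (r : ℝ) (v : Fin 3 → ℝ) : pauliVec (r • v) = (r : ℂ) • pauliVec v := by
  simp [pauliVec, Finset.smul_sum, mul_smul]

lemma isHermitian_pauliVec (v : Fin 3 → ℝ) : (pauliVec v).IsHermitian := by
  rw [pauliVec_eq]
  ext i j
  fin_cases i <;> fin_cases j <;> simp [sub_eq_add_neg]

@[simp] lemma trace_pauliVec (v : Fin 3 → ℝ) : (pauliVec v).trace = 0 := by
  simp [pauliVec_eq, Matrix.trace_fin_two]

lemma isHermitian_pauli (k : Fin 3) : (pauli k).IsHermitian :=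
  pauliVec_single k ▸ isHermitian_pauliVec _

@[simp] lemma trace_pauli (k : Fin 3) : (pauli k).trace = 0 :=
  pauliVec_single k ▸ trace_pauliVec _

lemma pauliVec_mul (v w : Fin 3 → ℝ) : pauliVec v * pauliVec w =
    ((v ⬝ᵥ w : ℝ) : ℂ) • (1 : M₂) + Complex.I • pauliVec (crossProduct v w) := by
  simp only [pauliVec_eq, cross_apply]
  ext i j
  fin_cases i <;> fin_cases j <;>
    simp [Matrix.mul_apply, Fin.sum_univ_two, dotProduct, Fin.sum_univ_three] <;>
    ring_nf <;> simp <;> ring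

lemma trace_pauliVec_mul (v w : Fin 3 → ℝ) :
    (pauliVec v * pauliVec w).trace = 2 * ((v ⬝ᵥ w : ℝ) : ℂ) := by
  rw [pauliVec_mul]
  simp [mul_comm]

lemma trace_pauli_mul_pauliVec (k : Fin 3) (w : Fin 3 → ℝ) :
    (pauli k * pauliVec w).trace = 2 * (w k : ℂ) := by
  rw [← pauliVec_single, trace_pauliVec_mul]
  simp

lemma eq_pauli_expansion (ρ : M₂) :
    ρ = (1 / 2 : ℂ) • (ρ.trace • (1 : M₂) + ∑ k, (pauli k * ρ).trace • pauli k) := by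
  ext i j
  fin_cases i <;> fin_cases j <;>
    simp [pauli, Fin.sum_univ_three, Matrix.trace_fin_two, Matrix.vecMul, vecHead, vecTail] <;>
    ring_nf <;> simp <;> ring

lemma ext_pauli {Φ Ψ : M₂ →ₗ[ℂ] M₂} (h1 : Φ 1 = Ψ 1) (h : ∀ k, Φ (pauli k) = Ψ (pauli k)) :
    Φ = Ψ := by
  ext1 ρ
  rw [eq_pauli_expansion ρ]
  simp [h1, h]

lemma exists_eq_of_isHermitian {A : M₂} (hA : A.IsHermitian) :
    ∃ (a : ℝ) (v : Fin 3 → ℝ), A = (a : ℂ) • 1 + pauliVec v := by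
  have h00 : (starRingEnd ℂ) (A 0 0) = A 0 0 := hA.apply 0 0
  have h11 : (starRingEnd ℂ) (A 1 1) = A 1 1 := hA.apply 1 1
  have h01 : (starRingEnd ℂ) (A 1 0) = A 0 1 := hA.apply 0 1
  rw [Complex.conj_eq_iff_im] at h00 h11
  refine ⟨((A 0 0).re + (A 1 1).re) / 2,
    ![(A 1 0).re, (A 1 0).im, ((A 0 0).re - (A 1 1).re) / 2], ?_⟩
  rw [pauliVec_eq]
  ext i j
  fin_cases i <;> fin_cases j <;> apply Complex.ext <;> simp [h00, h11, ← h01] <;> ring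

/-- The two eigenvalues have sum `2a` and product `a² - v · v`, and two reals are nonnegative
exactly when their sum and product are. -/
lemma posSemidef_iff (a : ℝ) (v : Fin 3 → ℝ) :
    ((a : ℂ) • (1 : M₂) + pauliVec v).PosSemidef ↔ 0 ≤ a ∧ v ⬝ᵥ v ≤ a ^ 2 := by
  have hH : ((a : ℂ) • (1 : M₂) + pauliVec v).IsHermitian := by
    refine Matrix.IsHermitian.add ?_ (isHermitian_pauliVec v)
    ext i j
    fin_cases i <;> fin_cases j <;> simp
  have htr : ((a : ℂ) • (1 : M₂) + pauliVec v).trace = ((2 * a : ℝ) : ℂ) := by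
    simp [mul_comm]
  have hdet : ((a : ℂ) • (1 : M₂) + pauliVec v).det = ((a ^ 2 - v ⬝ᵥ v : ℝ) : ℂ) := by
    rw [pauliVec_eq, Matrix.det_fin_two]
    simp [dotProduct, Fin.sum_univ_three]
    ring_nf
    simp
    ring
  constructor
  · intro h
    have h1 := h.trace_nonneg
    have h2 := h.det_nonneg
    rw [htr, Complex.zero_le_real] at h1
    rw [hdet, Complex.zero_le_real] at h2
    exact ⟨by linarith, by linarith⟩
  · rintro ⟨h1, h2⟩
    rw [hH.posSemidef_iff_eigenvalues_nonneg]
    rw [hH.trace_eq_sum_eigenvalues, Fin.sum_univ_two] at htr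
    rw [hH.det_eq_prod_eigenvalues, Fin.prod_univ_two] at hdet
    have htr' : hH.eigenvalues 0 + hH.eigenvalues 1 = 2 * a :=
      Complex.ofReal_injective (by rw [← htr]; push_cast; rfl)
    have hdet' : hH.eigenvalues 0 * hH.eigenvalues 1 = a ^ 2 - v ⬝ᵥ v :=
      Complex.ofReal_injective (by rw [← hdet]; push_cast; rfl)
    intro i
    fin_cases i <;> simp <;> by_contra! hneg <;> nlinarith

lemma posSemidef_one_add_pauliVec_iff (v : Fin 3 → ℝ) :
    ((1 : M₂) + pauliVec v).PosSemidef ↔ v ⬝ᵥ v ≤ 1 := by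
  simpa using posSemidef_iff 1 v

/-! ### Affine maps of the Bloch ball -/

/-- The trace preserving map acting on Bloch vectors as `w ↦ t + T w`. -/
def blochMap (t : Fin 3 → ℝ) (T : Matrix (Fin 3) (Fin 3) ℝ) : M₂ →ₗ[ℂ] M₂ where
  toFun ρ := (1 / 2 : ℂ) • (ρ.trace • (1 + pauliVec t) +
    ∑ l, (pauli l * ρ).trace • pauliVec (fun k => T k l))
  map_add' ρ ρ' := by
    simp only [Matrix.mul_add, Matrix.trace_add, Fin.sum_univ_three]
    module
  map_smul' c ρ := by
    simp only [Matrix.mul_smul, Matrix.trace_smul, Fin.sum_univ_three, smul_eq_mul,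
      RingHom.id_apply]
    module

lemma blochMap_apply (t : Fin 3 → ℝ) (T : Matrix (Fin 3) (Fin 3) ℝ) (ρ : M₂) :
    blochMap t T ρ = (1 / 2 : ℂ) • (ρ.trace • (1 + pauliVec t) +
      ∑ l, (pauli l * ρ).trace • pauliVec (fun k => T k l)) := rfl

@[simp] lemma blochMap_one (t : Fin 3 → ℝ) (T : Matrix (Fin 3) (Fin 3) ℝ) :
    blochMap t T 1 = 1 + pauliVec t := by
  simp [blochMap_apply, smul_smul]

@[simp] lemma blochMap_pauliVec (t : Fin 3 → ℝ) (T : Matrix (Fin 3) (Fin 3) ℝ) (v : Fin 3 → ℝ) :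
    blochMap t T (pauliVec v) = pauliVec (T *ᵥ v) := by
  simp only [blochMap_apply, trace_pauliVec, trace_pauli_mul_pauliVec]
  simp only [Finset.smul_sum, smul_smul, pauliVec, zero_smul, zero_add,
    Finset.sum_smul, mulVec, dotProduct, Complex.ofReal_sum, Complex.ofReal_mul]
  rw [Finset.sum_comm]
  refine Finset.sum_congr rfl fun k _ => Finset.sum_congr rfl fun l _ => ?_
  ring_nf

lemma blochMap_pauli (t : Fin 3 → ℝ) (T : Matrix (Fin 3) (Fin 3) ℝ) (l : Fin 3) :
    blochMap t T (pauli l) = pauliVec (fun k => T k l) := by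
  rw [← pauliVec_single, blochMap_pauliVec]
  congr 1
  ext
  simp

lemma canonicalMap_eq (t lam : Fin 3 → ℝ) : canonicalMap t lam = blochMap t (diagonal lam) := by
  ext1 ρ
  simp only [canonicalMap, blochMap_apply, LinearMap.coe_mk, AddHom.coe_mk]
  congr 1
  simp [pauliVec, diagonal_apply, smul_add, Finset.smul_sum, smul_smul, add_smul,
    Finset.sum_add_distrib, add_assoc, mul_comm, apply_ite, ite_smul, -Complex.coe_smul]

lemma exists_eq_blochMap {Φ : M₂ →ₗ[ℂ] M₂} (hTP : IsTracePreserving Φ) (h1 : (Φ 1).IsHermitian)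
    (h : ∀ k, (Φ (pauli k)).IsHermitian) : ∃ t T, Φ = blochMap t T := by
  obtain ⟨a, t, ht⟩ := exists_eq_of_isHermitian h1
  choose b T hT using fun k => exists_eq_of_isHermitian (h k)
  have ha : a = 1 := by
    have := hTP 1
    rw [ht] at this
    simp at this
    exact_mod_cast this
  have hb : ∀ k, b k = 0 := by
    intro k
    have := hTP (pauli k)
    rw [hT] at this
    simp at this
    exact this
  refine ⟨t, Matrix.of fun k l => T l k, ext_pauli ?_ fun k => ?_⟩
  · simp [ht, ha]
  · simp [hT, hb, blochMap_pauli]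

/-- Positivity of a map, as seen on the Bloch ball. -/
def IsPositiveMap (Φ : M₂ →ₗ[ℂ] M₂) : Prop := ∀ ρ : M₂, ρ.PosSemidef → (Φ ρ).PosSemidef

lemma IsCP.isPositiveMap {Φ : M₂ →ₗ[ℂ] M₂} (h : IsCP Φ) : IsPositiveMap Φ := by
  intro ρ hρ
  have := (h 1 (Matrix.of fun x y => ρ x.2 y.2) (hρ.submatrix Prod.snd)).submatrix
    fun a : Fin 2 => ((0 : Fin 1), a)
  exact this

lemma IsPositiveMap.isHermitian {Φ : M₂ →ₗ[ℂ] M₂} (h : IsPositiveMap Φ) :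
    (Φ 1).IsHermitian ∧ ∀ k, (Φ (pauli k)).IsHermitian := by
  have h1 : (Φ 1).IsHermitian := (h 1 .one).1
  refine ⟨h1, fun k => ?_⟩
  have h2 : ((1 : M₂) + pauli k).PosSemidef := by
    rw [← pauliVec_single, posSemidef_one_add_pauliVec_iff]
    simp
  have h3 := (h _ h2).1.sub h1
  rwa [map_add, add_sub_cancel_left] at h3

-- Positivity enters only through Hermiticity of the images of the Pauli basis, which makes the
-- affine parameters real.
lemma IsPositiveMap.exists_eq_blochMap {Φ : M₂ →ₗ[ℂ] M₂} (h : IsPositiveMap Φ)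
    (hTP : IsTracePreserving Φ) : ∃ t T, Φ = blochMap t T :=
  QubitMap.exists_eq_blochMap hTP h.isHermitian.1 h.isHermitian.2

/-! ### Rotations of the Bloch ball are unitary conjugations -/

/-- With determinant one the transpose equals the adjugate, whose entries are the components of
cross products of columns. -/
lemma crossProduct_col_of_mem_specialOrthogonal {R : Matrix (Fin 3) (Fin 3) ℝ} (hR : R * Rᵀ = 1)
    (hdet : R.det = 1) :
    crossProduct (R.col 0) (R.col 1) = R.col 2 ∧ crossProduct (R.col 1) (R.col 2) = R.col 0 ∧
      crossProduct (R.col 2) (R.col 0) = R.col 1 := by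
  have h : Rᵀ = R.adjugate := by
    have := congrArg (R.adjugate * ·) hR
    simpa [← Matrix.mul_assoc, adjugate_mul, hdet] using this
  have h' := fun i j => congrFun₂ h i j
  simp only [adjugate_fin_three, Matrix.transpose_apply] at h'
  have e00 := h' 0 0
  have e01 := h' 0 1
  have e02 := h' 0 2
  have e10 := h' 1 0
  have e11 := h' 1 1
  have e12 := h' 1 2
  have e20 := h' 2 0
  have e21 := h' 2 1
  have e22 := h' 2 2
  simp at e00 e01 e02 e10 e11 e12 e20 e21 e22
  refine ⟨?_, ?_, ?_⟩ <;> ext i <;> fin_cases i <;>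
    simp [cross_apply, Matrix.col_apply] <;> linarith

lemma exists_smul_one_of_commute {A : M₂} (h : ∀ k, A * pauli k = pauli k * A) :
    ∃ r : ℂ, A = r • 1 := by
  have h0 := congrFun₂ (h 0)
  have h2 := congrFun₂ (h 2)
  simp [pauli, Matrix.mul_apply, Fin.sum_univ_two, Fin.forall_fin_two] at h0 h2
  refine ⟨A 0 0, ?_⟩
  ext i j
  have e1 : A 0 1 = 0 := by linear_combination (-1 / 2 : ℂ) * h2.1
  have e2 : A 1 0 = 0 := by linear_combination (1 / 2 : ℂ) * h2.2
  fin_cases i <;> fin_cases j <;> simp [e1, e2, h0.2.1]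

/-- Two representations of the Pauli relations are related by a nonzero intertwiner. -/
lemma exists_intertwiner (s : Fin 3 → M₂) (hs : ∀ k, s k * s k = 1)
    (h01 : s 0 * s 1 = Complex.I • s 2) (h12 : s 1 * s 2 = Complex.I • s 0)
    (h20 : s 2 * s 0 = Complex.I • s 1) (h10 : s 1 * s 0 = -Complex.I • s 2)
    (h21 : s 2 * s 1 = -Complex.I • s 0) (h02 : s 0 * s 2 = -Complex.I • s 1) :
    ∃ X : M₂, X ≠ 0 ∧ ∀ k, s k * X = X * pauli k := by
  -- The average of `A` over the Pauli group acting by `s` on the left and by `pauli` on the right,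
  -- up to a factor.
  let X : M₂ → M₂ := fun A => A + ∑ l, s l * A * pauli l
  have hX : ∀ A k, s k * X A = X A * pauli k := by
    intro A k
    have p00 : pauli 0 * pauli 0 = 1 := by
      ext i j; fin_cases i <;> fin_cases j <;> simp [pauli]
    have p11 : pauli 1 * pauli 1 = 1 := by
      ext i j; fin_cases i <;> fin_cases j <;> simp [pauli]
    have p22 : pauli 2 * pauli 2 = 1 := by
      ext i j; fin_cases i <;> fin_cases j <;> simp [pauli]
    have p01 : pauli 0 * pauli 1 = Complex.I • pauli 2 := by
      ext i j; fin_cases i <;> fin_cases j <;> simp [pauli]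
    have p12 : pauli 1 * pauli 2 = Complex.I • pauli 0 := by
      ext i j; fin_cases i <;> fin_cases j <;> simp [pauli]
    have p20 : pauli 2 * pauli 0 = Complex.I • pauli 1 := by
      ext i j; fin_cases i <;> fin_cases j <;> simp [pauli]
    have p10 : pauli 1 * pauli 0 = -Complex.I • pauli 2 := by
      ext i j; fin_cases i <;> fin_cases j <;> simp [pauli]
    have p21 : pauli 2 * pauli 1 = -Complex.I • pauli 0 := by
      ext i j; fin_cases i <;> fin_cases j <;> simp [pauli]
    have p02 : pauli 0 * pauli 2 = -Complex.I • pauli 1 := by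
      ext i j; fin_cases i <;> fin_cases j <;> simp [pauli]
    simp only [X, Fin.sum_univ_three]
    have e : ∀ k, s k * (A + (s 0 * A * pauli 0 + s 1 * A * pauli 1 + s 2 * A * pauli 2)) =
        s k * A + ((s k * s 0) * A * pauli 0 + (s k * s 1) * A * pauli 1 +
          (s k * s 2) * A * pauli 2) := fun k => by
      simp only [Matrix.mul_add, Matrix.mul_assoc]
    have e' : ∀ k, (A + (s 0 * A * pauli 0 + s 1 * A * pauli 1 + s 2 * A * pauli 2)) * pauli k =
        A * pauli k + (s 0 * A * (pauli 0 * pauli k) + s 1 * A * (pauli 1 * pauli k) +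
          s 2 * A * (pauli 2 * pauli k)) := fun k => by
      simp only [Matrix.add_mul, Matrix.mul_assoc]
    rw [e, e']
    fin_cases k <;>
      simp [hs, h01, h12, h20, h10, h21, h02, p00, p11, p22, p01, p12, p20, p10, p21, p02] <;>
      abel
  by_contra! hcon
  have h0 : ∀ A, X A = 0 := fun A => by
    by_contra h
    obtain ⟨k, hk⟩ := hcon _ h
    exact hk (hX A k)
  -- These two entries are `1 + s 2 0 0` and `1 - s 2 0 0`; they cannot both vanish.
  have e0 := congrFun₂ (h0 !![1, 0; 0, 0]) 0 0
  have e1 := congrFun₂ (h0 !![0, 1; 0, 0]) 0 1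
  simp [X, Fin.sum_univ_three, pauli, Matrix.mul_apply, Fin.sum_univ_two] at e0 e1
  have : (2 : ℂ) = 0 := by linear_combination e0 + e1
  norm_num at this

/-- As the `s k` are Hermitian, `Xᴴ * X` commutes with the Pauli matrices, hence is a positive
scalar, and rescaling `X` gives a unitary. -/
lemma exists_unitary_of_intertwiner {s : Fin 3 → M₂} (hs : ∀ k, (s k).IsHermitian) {X : M₂}
    (hX : X ≠ 0) (h : ∀ k, s k * X = X * pauli k) :
    ∃ U ∈ unitaryGroup (Fin 2) ℂ, ∀ k, U * pauli k * Uᴴ = s k := by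
  have h' : ∀ k, Xᴴ * s k = pauli k * Xᴴ := fun k => by
    have := congrArg conjTranspose (h k)
    rwa [conjTranspose_mul, conjTranspose_mul, (hs k).eq, (isHermitian_pauli k).eq] at this
  obtain ⟨r, hr⟩ := exists_smul_one_of_commute (A := Xᴴ * X) fun k => by
    rw [Matrix.mul_assoc, ← h, ← Matrix.mul_assoc, h', Matrix.mul_assoc]
  have hr0 : 0 ≤ r := by
    have := (posSemidef_conjTranspose_mul_self X).diag_nonneg (i := 0)
    rw [hr] at this
    simpa using this
  have hne : r ≠ 0 := by
    rintro rfl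
    rw [zero_smul] at hr
    exact hX (conjTranspose_mul_self_eq_zero.mp hr)
  obtain ⟨hre, him⟩ := Complex.le_def.mp hr0
  obtain ⟨q, rfl⟩ : ∃ q : ℝ, r = q := ⟨r.re, Complex.ext (by simp) (by simpa using him.symm)⟩
  have hq : 0 < q := lt_of_le_of_ne (by simpa using hre) (by rintro rfl; simp at hne)
  have hU : (((√q)⁻¹ : ℝ) : ℂ) • X ∈ unitaryGroup (Fin 2) ℂ := by
    rw [mem_unitaryGroup_iff', star_eq_conjTranspose, conjTranspose_smul, Matrix.smul_mul,
      Matrix.mul_smul, hr, smul_smul, smul_smul]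
    have : (√q)⁻¹ * (√q)⁻¹ * q = 1 := by
      rw [← mul_inv, Real.mul_self_sqrt hq.le, inv_mul_cancel₀ hq.ne']
    have h2 : star (((√q)⁻¹ : ℝ) : ℂ) = (((√q)⁻¹ : ℝ) : ℂ) := Complex.conj_ofReal _
    rw [h2, ← Complex.ofReal_mul, ← Complex.ofReal_mul, this]
    simp
  refine ⟨_, hU, fun k => ?_⟩
  rw [Matrix.smul_mul, ← h, ← Matrix.mul_smul, Matrix.mul_assoc, unitary_mul_conjTranspose hU,
    Matrix.mul_one]

/-- Surjectivity of `SU(2) → SO(3)` in the form needed. A rotation preserves dot and cross products,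
so the rotated Pauli matrices obey the same relations and are intertwined with the original ones. -/
lemma exists_unitary_of_rotation {R : Matrix (Fin 3) (Fin 3) ℝ} (hR : R * Rᵀ = 1)
    (hdet : R.det = 1) :
    ∃ U ∈ unitaryGroup (Fin 2) ℂ, ∀ v, U * pauliVec v * Uᴴ = pauliVec (R *ᵥ v) := by
  obtain ⟨c1, c2, c3⟩ := crossProduct_col_of_mem_specialOrthogonal hR hdet
  have hdot : ∀ i j, R.col i ⬝ᵥ R.col j = (1 : Matrix (Fin 3) (Fin 3) ℝ) i j := by
    intro i j
    rw [← mul_eq_one_comm.mp hR]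
    rfl
  obtain ⟨X, hX, hX'⟩ := exists_intertwiner (fun k => pauliVec (R.col k))
    (fun k => by rw [pauliVec_mul, hdot]; simp [pauliVec])
    (by rw [pauliVec_mul, hdot, c1]; simp)
    (by rw [pauliVec_mul, hdot, c2]; simp)
    (by rw [pauliVec_mul, hdot, c3]; simp)
    (by rw [pauliVec_mul, hdot, ← cross_anticomm, c1, pauliVec_neg]; simp)
    (by rw [pauliVec_mul, hdot, ← cross_anticomm, c2, pauliVec_neg]; simp)
    (by rw [pauliVec_mul, hdot, ← cross_anticomm, c3, pauliVec_neg]; simp)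
  obtain ⟨U, hU, h⟩ := exists_unitary_of_intertwiner (fun k => isHermitian_pauliVec _) hX hX'
  refine ⟨U, hU, fun v => ?_⟩
  have e1 : U * pauliVec v * Uᴴ = ∑ k, (v k : ℂ) • (U * pauli k * Uᴴ) := by
    simp [pauliVec, Finset.mul_sum, Finset.sum_mul]
  rw [e1]
  simp only [h, pauliVec, Finset.smul_sum, smul_smul, mulVec, dotProduct, Finset.sum_smul,
    Complex.ofReal_sum, Complex.ofReal_mul]
  rw [Finset.sum_comm]
  simp only [mul_comm, Matrix.col_apply]

/-! ### Canonical forms -/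

lemma transpose_mul_self_of_orthonormalBasis
    (b : OrthonormalBasis (Fin 3) ℝ (EuclideanSpace ℝ (Fin 3))) :
    (Matrix.of fun i j => b j i)ᵀ * (Matrix.of fun i j => b j i) = 1 := by
  ext i j
  have := orthonormal_iff_ite.mp b.orthonormal j i
  rw [EuclideanSpace.inner_eq_star_dotProduct] at this
  simpa [Matrix.mul_apply, dotProduct, Matrix.one_apply, eq_comm] using this

/-- The real singular value decomposition: `T` sends an orthonormal eigenbasis of `Tᵀ * T` to
orthogonal vectors, and the nonzero ones are normalised and completed to an orthonormal basis. -/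
lemma exists_orthogonal_diagonalization (T : Matrix (Fin 3) (Fin 3) ℝ) :
    ∃ (P Q : Matrix (Fin 3) (Fin 3) ℝ) (d : Fin 3 → ℝ), P * Pᵀ = 1 ∧ Q * Qᵀ = 1 ∧
      T = P * diagonal d * Qᵀ := by
  have hH : (Tᵀ * T).IsHermitian := by
    simpa using isHermitian_conjTranspose_mul_self T
  let b := hH.eigenvectorBasis
  let w : Fin 3 → EuclideanSpace ℝ (Fin 3) := fun i => WithLp.toLp 2 (T *ᵥ (b i).ofLp)
  have hw : ∀ i j, i ≠ j → inner ℝ (w i) (w j) = 0 := by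
    intro i j hij
    have h1 : (b i).ofLp ⬝ᵥ (b j).ofLp = 0 := by
      have : inner ℝ (b j) (b i) = (0 : ℝ) := b.orthonormal.2 hij.symm
      rw [EuclideanSpace.inner_eq_star_dotProduct] at this
      simpa using this
    have h2 : (Tᵀ * T) *ᵥ (b j).ofLp = hH.eigenvalues j • (b j).ofLp :=
      hH.mulVec_eigenvectorBasis j
    rw [real_inner_comm, EuclideanSpace.inner_eq_star_dotProduct]
    simp only [w, star_trivial]
    rw [dotProduct_mulVec, vecMul_mulVec, ← dotProduct_mulVec, h2]
    simp [h1]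
  have hu : Orthonormal ℝ ({i | w i ≠ 0}.domRestrict fun i => (‖w i‖⁻¹ : ℝ) • w i) := by
    refine ⟨fun i => ?_, fun i j hij => ?_⟩
    · simp only [Set.domRestrict_apply, norm_smul, norm_inv, norm_norm]
      exact inv_mul_cancel₀ (norm_ne_zero_iff.mpr i.2)
    · simp [inner_smul_left, inner_smul_right, hw i j fun h => hij (Subtype.ext h)]
  obtain ⟨u, hu⟩ := hu.exists_orthonormalBasis_extension_of_card_eq (by simp)
  have hwu : ∀ i, w i = ‖w i‖ • u i := by
    intro i
    by_cases h : w i = 0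
    · simp [h]
    · rw [hu i h, smul_smul, mul_inv_cancel₀ (norm_ne_zero_iff.mpr h), one_smul]
  have hQ := transpose_mul_self_of_orthonormalBasis b
  refine ⟨Matrix.of fun i j => u j i, Matrix.of fun i j => b j i, fun i => ‖w i‖,
    mul_eq_one_comm.mp (transpose_mul_self_of_orthonormalBasis u), mul_eq_one_comm.mp hQ, ?_⟩
  have key : T * (Matrix.of fun i j => b j i) =
      (Matrix.of fun i j => u j i) * diagonal fun i => ‖w i‖ := by
    ext i j
    have := congrArg (fun x : EuclideanSpace ℝ (Fin 3) => x i) (hwu j)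
    simpa [w, Matrix.mul_apply, mulVec, dotProduct, diagonal_apply, mul_comm] using this
  rw [← key, Matrix.mul_assoc, mul_eq_one_comm.mp hQ, Matrix.mul_one]

/-- In odd dimension, multiplying an orthogonal matrix by its determinant makes it a rotation. The
signs go into `d`, which may therefore have negative entries. -/
lemma exists_rotation_diagonalization (T : Matrix (Fin 3) (Fin 3) ℝ) :
    ∃ (P Q : Matrix (Fin 3) (Fin 3) ℝ) (d : Fin 3 → ℝ), P * Pᵀ = 1 ∧ P.det = 1 ∧ Q * Qᵀ = 1 ∧
      Q.det = 1 ∧ T = P * diagonal d * Qᵀ := by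
  have aux : ∀ P : Matrix (Fin 3) (Fin 3) ℝ, P * Pᵀ = 1 →
      ∃ e : ℝ, e * e = 1 ∧ (e • P).det = 1 ∧ (e • P) * (e • P)ᵀ = 1 := by
    intro P hP
    have h1 : P.det * P.det = 1 := by
      simpa using congrArg det hP
    refine ⟨P.det, h1, ?_, ?_⟩
    · rw [det_smul, Fintype.card_fin]
      linear_combination (P.det * P.det + 1) * h1
    · rw [transpose_smul, Matrix.smul_mul, Matrix.mul_smul, smul_smul, hP, h1, one_smul]
  obtain ⟨P, Q, d, hP, hQ, rfl⟩ := exists_orthogonal_diagonalization T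
  obtain ⟨e, he, hPd, hP'⟩ := aux P hP
  obtain ⟨f, hf, hQd, hQ'⟩ := aux Q hQ
  refine ⟨e • P, f • Q, (e * f) • d, hP', hPd, hQ', hQd, ?_⟩
  have : diagonal ((e * f) • d) = (e * f) • diagonal d := diagonal_smul _ _
  rw [this, transpose_smul]
  simp only [Matrix.smul_mul, Matrix.mul_smul, smul_smul]
  rw [show f * (e * f * e) = 1 by linear_combination he * f * f + hf, one_smul]

lemma exists_isCanonicalForm_blochMap (t : Fin 3 → ℝ) (T : Matrix (Fin 3) (Fin 3) ℝ) :
    ∃ t' lam, IsCanonicalForm (blochMap t T) t' lam := by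
  obtain ⟨P, Q, d, hP, hPd, hQ, hQd, rfl⟩ := exists_rotation_diagonalization T
  obtain ⟨U, hU, hU'⟩ := exists_unitary_of_rotation hP hPd
  obtain ⟨V, hV, hV'⟩ := exists_unitary_of_rotation (R := Qᵀ)
    (by rw [transpose_transpose, mul_eq_one_comm.mp hQ]) (by rw [det_transpose, hQd])
  refine ⟨Pᵀ *ᵥ t, d, isCanonicalForm_iff.mpr ⟨U, hU, V, hV, ext_pauli ?_ fun k => ?_⟩⟩
  · simp [canonicalMap_eq, unitary_mul_conjTranspose hV, Matrix.mul_add, Matrix.add_mul,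
      unitary_mul_conjTranspose hU, hU', hP]
  · rw [← pauliVec_single]
    simp only [LinearMap.comp_apply, conjMap_apply, hV', canonicalMap_eq, blochMap_pauliVec, hU',
      mulVec_mulVec, Matrix.mul_assoc]

/-! ### The trace pairing of maps -/

/-- The bilinear pairing of maps given, up to normalisation, by the trace of the product of Choi
matrices. -/
def pairing (Ψ Φ : M₂ →ₗ[ℂ] M₂) : ℂ :=
  (Ψ 1 * Φ 1).trace + ∑ k, (Ψ (pauli k) * Φ (pauli k)).trace

lemma pairing_add_left (Ψ Ψ' Φ : M₂ →ₗ[ℂ] M₂) :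
    pairing (Ψ + Ψ') Φ = pairing Ψ Φ + pairing Ψ' Φ := by
  simp only [pairing, LinearMap.add_apply, Matrix.add_mul, Matrix.trace_add,
    Finset.sum_add_distrib]
  ring

lemma pairing_smul_left (a : ℝ) (Ψ Φ : M₂ →ₗ[ℂ] M₂) :
    pairing (a • Ψ) Φ = a * pairing Ψ Φ := by
  simp [pairing, Finset.mul_sum, mul_add]

/-- Among the basis matrices the transpose changes only the sign of `pauli 1`, and that sign can be
placed on either factor. -/
lemma pairing_comp_transposeMap (Ψ Φ : M₂ →ₗ[ℂ] M₂) :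
    pairing (Ψ ∘ₗ transposeMap) Φ = pairing Ψ (Φ ∘ₗ transposeMap) := by
  have h0 : (pauli 0)ᵀ = pauli 0 := by
    ext i j; fin_cases i <;> fin_cases j <;> simp [pauli]
  have h1 : (pauli 1)ᵀ = -pauli 1 := by
    ext i j; fin_cases i <;> fin_cases j <;> simp [pauli]
  have h2 : (pauli 2)ᵀ = pauli 2 := by
    ext i j; fin_cases i <;> fin_cases j <;> simp [pauli]
  simp [pairing, Fin.sum_univ_three, h0, h1, h2]

/-- The pairing is twice the quadratic form of the Choi matrix of `Φ` at the vector formed by the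
entries of `A`. -/
lemma IsCP.pairing_conjMap_nonneg {Φ : M₂ →ₗ[ℂ] M₂} (h : IsCP Φ) (A : M₂) :
    0 ≤ (pairing (conjMap A) Φ).re := by
  -- The unnormalised maximally entangled vector, whose blocks are the matrix units.
  let w : Fin 2 × Fin 2 → ℂ := fun x => if x.1 = x.2 then 1 else 0
  have hC := h 2 _ (posSemidef_vecMulVec_self_star w)
  have hpos := (hC.re_dotProduct_nonneg fun x => A x.2 x.1)
  have hblock : ∀ i j, (Matrix.of fun c d => vecMulVec w (star w) (i, c) (j, d)) =
      Matrix.single i j (1 : ℂ) := by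
    intro i j
    ext c d
    fin_cases i <;> fin_cases j <;> fin_cases c <;> fin_cases d <;> simp [w, vecMulVec_apply]
  have e1 : (1 : M₂) = single 0 0 1 + single 1 1 1 := by
    ext i j; fin_cases i <;> fin_cases j <;> simp
  have p0 : pauli 0 = single 0 1 1 + single 1 0 1 := by
    ext i j; fin_cases i <;> fin_cases j <;> simp [pauli]
  have p1 : pauli 1 = (-Complex.I) • single 0 1 1 + Complex.I • single 1 0 1 := by
    ext i j; fin_cases i <;> fin_cases j <;> simp [pauli]
  have p2 : pauli 2 = single 0 0 1 - single 1 1 1 := by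
    ext i j; fin_cases i <;> fin_cases j <;> simp [pauli]
  have key : pairing (conjMap A) Φ = 2 * (star (fun x : Fin 2 × Fin 2 => A x.2 x.1) ⬝ᵥ
      (idTensor 2 Φ (vecMulVec w (star w)) *ᵥ fun x => A x.2 x.1)) := by
    simp only [pairing, Fin.sum_univ_three, p0, p1, p2, e1, map_add, map_sub, map_smul,
      conjMap_apply]
    simp only [idTensor, hblock]
    simp [dotProduct, mulVec, Fintype.sum_prod_type, Fin.sum_univ_two, Matrix.trace_fin_two,
      Matrix.mul_apply]
    ring_nf
    simp only [Complex.I_sq]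
    ring
  rw [key]
  have h2 : ((2 : ℂ)).im = 0 := rfl
  rw [Complex.mul_re, h2, zero_mul, sub_zero]
  exact mul_nonneg (by norm_num) hpos

/-! ### Decomposability of unital trace preserving positive maps -/

/-- The sign vectors with product `1` come from conjugation by the identity and the three Pauli
matrices (`pauli 0 * pauli 2` is a multiple of `pauli 1`); flipping the middle sign yields the other
four. -/
lemma canonicalMap_vertex {s : Fin 3 → ℝ} (hs : s ∈ Set.univ.pi fun _ => ({-1, 1} : Set ℝ)) :
    ∃ W : M₂, canonicalMap 0 s = conjMap W ∨ canonicalMap 0 s = conjMap W ∘ₗ transposeMap := by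
  have h1 : canonicalMap 0 ![1, 1, 1] = conjMap 1 := by
    rw [canonicalMap_eq]
    refine ext_pauli ?_ fun k => ?_
    · simp [pauliVec]
    · have : diagonal ![(1 : ℝ), 1, 1] = 1 := by
        rw [← diagonal_one]
        congr 1
        ext k
        fin_cases k <;> rfl
      rw [← pauliVec_single, blochMap_pauliVec, this, one_mulVec]
      simp
  have h0 : canonicalMap 0 ![1, -1, -1] = conjMap (pauli 0) := by
    rw [← one_mul (pauli 0), ← conjMap_comp, ← h1, canonicalMap_comp_conjMap_pauli_zero]
    congr 1
    ext k
    fin_cases k <;> simp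
  have h2 : canonicalMap 0 ![-1, -1, 1] = conjMap (pauli 2) := by
    rw [← one_mul (pauli 2), ← conjMap_comp, ← h1, canonicalMap_comp_conjMap_pauli_two]
    congr 1
    ext k
    fin_cases k <;> simp
  have h3 : canonicalMap 0 ![-1, 1, -1] = conjMap (pauli 0 * pauli 2) := by
    rw [← conjMap_comp, ← h0, canonicalMap_comp_conjMap_pauli_two]
    congr 1
    ext k
    fin_cases k <;> simp
  have hT : ∀ a b c : ℝ, canonicalMap 0 ![a, -b, c] = canonicalMap 0 ![a, b, c] ∘ₗ transposeMap := by
    intro a b c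
    rw [canonicalMap_comp_transposeMap]
    congr 1
    ext k
    fin_cases k <;> simp
  have hT' : ∀ a c : ℝ, canonicalMap 0 ![a, 1, c] = canonicalMap 0 ![a, -1, c] ∘ₗ transposeMap := by
    intro a c
    rw [← hT, neg_neg]
  have hs' : s = ![s 0, s 1, s 2] := by
    ext k
    fin_cases k <;> rfl
  simp only [Set.mem_pi, Set.mem_univ, Set.mem_insert_iff, Set.mem_singleton_iff,
    forall_const] at hs
  rw [hs']
  rcases hs 0 with e0 | e0 <;> rcases hs 1 with e1 | e1 <;> rcases hs 2 with e2 | e2 <;>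
    rw [e0, e1, e2]
  · exact ⟨_, .inr (by rw [hT, h3])⟩
  · exact ⟨_, .inl h2⟩
  · exact ⟨_, .inl h3⟩
  · exact ⟨_, .inr (by rw [hT', h2])⟩
  · exact ⟨_, .inl h0⟩
  · exact ⟨_, .inr (by rw [hT, h1])⟩
  · exact ⟨_, .inr (by rw [hT', h0])⟩
  · exact ⟨_, .inl h1⟩

lemma canonicalMap_combo (t s s' : Fin 3 → ℝ) {a b : ℝ} (hab : a + b = 1) :
    canonicalMap t (a • s + b • s') = a • canonicalMap t s + b • canonicalMap t s' := by
  simp only [canonicalMap_eq]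
  refine ext_pauli ?_ fun k => ?_
  · rw [LinearMap.add_apply, LinearMap.smul_apply, LinearMap.smul_apply]
    simp only [blochMap_one]
    rw [← add_smul, hab, one_smul]
  · rw [LinearMap.add_apply, LinearMap.smul_apply, LinearMap.smul_apply, ← pauliVec_single]
    simp only [blochMap_pauliVec]
    rw [← Complex.coe_smul, ← Complex.coe_smul, ← pauliVec_smul, ← pauliVec_smul, ← pauliVec_add]
    congr 1
    ext j
    obtain rfl | hjk := eq_or_ne j k
    · simp
    · simp [hjk]

/-- The pairing is affine in `s` and the cube is the hull of its vertices. At a vertex, complete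
positivity of `Φ` or of `Φ ∘ T` applies. -/
lemma pairing_canonicalMap_nonneg {Φ : M₂ →ₗ[ℂ] M₂} (h : IsCP Φ)
    (h' : IsCP (Φ ∘ₗ transposeMap)) (A V : M₂) {s : Fin 3 → ℝ} (hs : ∀ k, |s k| ≤ 1) :
    0 ≤ (pairing (conjMap A ∘ₗ canonicalMap 0 s ∘ₗ conjMap V) Φ).re := by
  have hmem : s ∈ convexHull ℝ (Set.univ.pi fun _ : Fin 3 => ({-1, 1} : Set ℝ)) := by
    rw [convexHull_pi]
    intro k _
    rw [convexHull_pair, segment_eq_Icc (by norm_num)]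
    exact abs_le.mp (hs k)
  refine convexHull_min (t := {s : Fin 3 → ℝ |
    0 ≤ (pairing (conjMap A ∘ₗ canonicalMap 0 s ∘ₗ conjMap V) Φ).re}) ?_ ?_ hmem
  · intro s hs
    obtain ⟨W, hW | hW⟩ := canonicalMap_vertex hs
    · simp only [Set.mem_ofPred_eq, hW, conjMap_comp]
      exact h.pairing_conjMap_nonneg _
    · simp only [Set.mem_ofPred_eq, hW, LinearMap.comp_assoc, transposeMap_comp_conjMap]
      rw [← LinearMap.comp_assoc, ← LinearMap.comp_assoc, conjMap_comp, conjMap_comp,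
        pairing_comp_transposeMap]
      exact h'.pairing_conjMap_nonneg _
  · intro s hs s' hs' a b ha hb hab
    simp only [Set.mem_ofPred_eq] at hs hs' ⊢
    rw [canonicalMap_combo _ _ _ hab, LinearMap.add_comp, LinearMap.comp_add, LinearMap.smul_comp,
      LinearMap.smul_comp, LinearMap.comp_smul, LinearMap.comp_smul, pairing_add_left,
      pairing_smul_left, pairing_smul_left, Complex.add_re, Complex.re_ofReal_mul,
      Complex.re_ofReal_mul]
    exact add_nonneg (mul_nonneg ha hs) (mul_nonneg hb hs')

lemma isPositiveMap_conjMap (A : M₂) : IsPositiveMap (conjMap A) :=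
  fun _ hρ => hρ.mul_mul_conjTranspose_same A

/-- In canonical form, unitality kills the translation, and positivity on `1 + pauli k` bounds each
diagonal parameter by one. -/
lemma pairing_nonneg_of_unital {Φ Ψ : M₂ →ₗ[ℂ] M₂} (h : IsCP Φ)
    (h' : IsCP (Φ ∘ₗ transposeMap)) (hpos : IsPositiveMap Ψ) (hTP : IsTracePreserving Ψ)
    (hone : Ψ 1 = 1) (A : M₂) : 0 ≤ (pairing (conjMap A ∘ₗ Ψ) Φ).re := by
  obtain ⟨t, T, hΨ⟩ := hpos.exists_eq_blochMap hTP
  obtain ⟨t', s, hcan⟩ := exists_isCanonicalForm_blochMap t T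
  rw [← hΨ, isCanonicalForm_iff] at hcan
  obtain ⟨U, hU, V, hV, hcan⟩ := hcan
  have hinv : conjMap Uᴴ ∘ₗ Ψ ∘ₗ conjMap Vᴴ = canonicalMap t' s := by
    rw [hcan, LinearMap.comp_assoc, LinearMap.comp_assoc, ← LinearMap.comp_assoc,
      conjMap_conjTranspose_comp hU, conjMap_comp_conjTranspose hV, LinearMap.id_comp,
      LinearMap.comp_id]
  have ht' : t' = 0 := by
    have h1 : canonicalMap t' s 1 = 1 := by
      rw [← hinv]
      simp [unitary_conjTranspose_mul hV, unitary_conjTranspose_mul hU, hone]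
    rw [canonicalMap_eq, blochMap_one, add_eq_left] at h1
    ext k
    have := trace_pauli_mul_pauliVec k t'
    rw [h1] at this
    simpa using this.symm
  have hs : ∀ k, |s k| ≤ 1 := by
    intro k
    have h1 : ((1 : M₂) + pauli k).PosSemidef := by
      rw [← pauliVec_single, posSemidef_one_add_pauliVec_iff]
      simp
    have h2 : (canonicalMap t' s (1 + pauli k)).PosSemidef := by
      rw [← hinv, LinearMap.comp_apply, LinearMap.comp_apply]
      have h3 := hpos _ (isPositiveMap_conjMap Vᴴ _ h1)
      exact isPositiveMap_conjMap Uᴴ _ h3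
    rw [canonicalMap_eq, map_add, blochMap_one, ht', ← pauliVec_single, blochMap_pauliVec,
      pauliVec_zero, add_zero, diagonal_mulVec_single, mul_one] at h2
    rw [abs_le_one_iff_mul_self_le_one]
    simpa using (posSemidef_one_add_pauliVec_iff _).mp h2
  rw [hcan, ← LinearMap.comp_assoc, conjMap_comp, ht']
  exact pairing_canonicalMap_nonneg h h' _ _ hs

/-! ### Convex hulls of compact sets in finite dimension -/

/-- By Carathéodory, `dim E + 1` points suffice, so the hull is a continuous image of a simplex
times a power of `s`. -/
lemma isCompact_convexHull_of_finiteDimensional {E : Type*} [NormedAddCommGroup E]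
    [NormedSpace ℝ E] [FiniteDimensional ℝ E] {s : Set E} (hs : IsCompact s) :
    IsCompact (convexHull ℝ s) := by
  obtain rfl | ⟨x₀, hx₀⟩ := s.eq_empty_or_nonempty
  · simp
  let d := Module.finrank ℝ E + 1
  let F : (Fin d → ℝ) × (Fin d → E) → E := fun p => ∑ i, p.1 i • p.2 i
  have hF : Continuous F := by fun_prop
  have hK : IsCompact ((stdSimplex ℝ (Fin d)) ×ˢ (Set.univ.pi fun _ : Fin d => s)) :=
    (isCompact_stdSimplex ℝ (Fin d)).prod (isCompact_univ_pi fun _ => hs)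
  convert hK.image hF
  ext x
  constructor
  · intro hx
    obtain ⟨ι, _, z, w, hz, hind, hw, hw1, rfl⟩ := eq_pos_convex_span_of_mem_convexHull hx
    have hcard : Fintype.card ι ≤ Fintype.card (Fin d) := by
      rw [Fintype.card_fin]
      exact hind.card_le_finrank_succ.trans (Nat.succ_le_succ (Submodule.finrank_le _))
    obtain ⟨e⟩ := Function.Embedding.nonempty_of_card_le hcard
    -- Shorter combinations are padded with weight `0` at the fixed point `x₀`.
    refine ⟨(Function.extend e w 0, Function.extend e z fun _ => x₀),
      ⟨⟨fun j => ?_, ?_⟩, fun j _ => ?_⟩, ?_⟩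
    · by_cases h : ∃ i, e i = j
      · obtain ⟨i, rfl⟩ := h
        simpa [e.injective.extend_apply] using (hw i).le
      · simp [Function.extend_apply' _ _ _ h]
    · rw [← hw1]
      symm
      refine Fintype.sum_of_injective e e.injective _ _ (fun j h => ?_) fun i => ?_
      · exact Function.extend_apply' _ _ _ h
      · exact (e.injective.extend_apply _ _ _).symm
    · by_cases h : ∃ i, e i = j
      · obtain ⟨i, rfl⟩ := h
        simpa [e.injective.extend_apply] using hz ⟨i, rfl⟩
      · simpa [Function.extend_apply' _ _ _ h] using hx₀
    · symm
      refine Fintype.sum_of_injective e e.injective _ _ (fun j h => ?_) fun i => ?_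
      · simp only
        rw [Function.extend_apply' _ _ _ h]
        simp
      · simp only [e.injective.extend_apply]
  · rintro ⟨⟨w, z⟩, ⟨⟨hw, hw1⟩, hz⟩, rfl⟩
    exact (convex_convexHull ℝ s).sum_mem (fun i _ => hw i) hw1
      fun i _ => subset_convexHull ℝ s (hz i trivial)

/-! ### Classical-quantum maps in Bloch coordinates -/

/-- The closed unit ball of `ℝ³` for the Euclidean norm. -/
def blochBall : Set (Fin 3 → ℝ) := {v | v ⬝ᵥ v ≤ 1}

lemma isCompact_blochBall : IsCompact blochBall := by
  refine (isCompact_Icc (a := fun _ => (-1 : ℝ)) (b := fun _ => (1 : ℝ))).of_isClosed_subset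
    (isClosed_le (by unfold dotProduct; fun_prop) continuous_const) fun v hv => ?_
  have hv' : v 0 * v 0 + v 1 * v 1 + v 2 * v 2 ≤ 1 := by
    simpa [blochBall, dotProduct, Fin.sum_univ_three] using hv
  rw [← Set.pi_univ_Icc]
  intro k _
  rw [Set.mem_Icc, ← abs_le, abs_le_one_iff_mul_self_le_one]
  have h0 := mul_self_nonneg (v 0)
  have h1 := mul_self_nonneg (v 1)
  have h2 := mul_self_nonneg (v 2)
  fin_cases k
  all_goals simp
  all_goals linarith

lemma isDensity_of_mem_blochBall {v : Fin 3 → ℝ} (hv : v ∈ blochBall) :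
    IsDensity ((1 / 2 : ℂ) • ((1 : M₂) + pauliVec v)) := by
  refine ⟨((posSemidef_one_add_pauliVec_iff v).mpr hv).smul ?_, by simp⟩
  rw [show (1 / 2 : ℂ) = ((1 / 2 : ℝ) : ℂ) by simp, Complex.zero_le_real]
  norm_num

lemma isRankOneProjection_of_unit {n : Fin 3 → ℝ} (hn : n ⬝ᵥ n = 1) :
    IsRankOneProjection ((1 / 2 : ℂ) • ((1 : M₂) + pauliVec n)) := by
  have hn' : n 0 * n 0 + n 1 * n 1 + n 2 * n 2 = 1 := by
    simpa [dotProduct, Fin.sum_univ_three] using hn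
  -- The spinor used in the other case divides by `√((1 + n 2) / 2)`, so the south pole is treated
  -- separately.
  by_cases h : n 2 = -1
  · have h0 : n 0 = 0 := by nlinarith [mul_self_nonneg (n 0), mul_self_nonneg (n 1)]
    have h1 : n 1 = 0 := by nlinarith [mul_self_nonneg (n 0), mul_self_nonneg (n 1)]
    refine ⟨![0, 1], by simp [dotProduct, Fin.sum_univ_two], ?_⟩
    rw [pauliVec_eq]
    ext i j
    fin_cases i <;> fin_cases j <;> norm_num [h, h0, h1, vecMulVec_apply]
  · have hpos : 0 < (1 + n 2) / 2 := by
      have : -1 ≤ n 2 := by nlinarith [mul_self_nonneg (n 0), mul_self_nonneg (n 1)]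
      have := lt_of_le_of_ne this (Ne.symm h)
      linarith
    set p : ℝ := √((1 + n 2) / 2) with hp
    have hp0 : p ≠ 0 := (Real.sqrt_pos.mpr hpos).ne'
    have hpp : p * p = (1 + n 2) / 2 := Real.mul_self_sqrt hpos.le
    have hpC : (p : ℂ) ≠ 0 := by exact_mod_cast hp0
    have hppC : (p : ℂ) * p = (1 + n 2) / 2 := by exact_mod_cast hpp
    have hnC : (n 0 : ℂ) * n 0 + n 1 * n 1 = (1 - n 2) * (1 + n 2) := by
      have : n 0 * n 0 + n 1 * n 1 = (1 - n 2) * (1 + n 2) := by linarith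
      exact_mod_cast this
    have hq : ((n 0 : ℂ) - Complex.I * n 1) / (2 * p) * (((n 0 : ℂ) + Complex.I * n 1) / (2 * p)) =
        (1 - n 2) / 2 := by
      rw [div_mul_div_comm, div_eq_iff (by positivity)]
      linear_combination hnC - (n 1 : ℂ) ^ 2 * Complex.I_sq - 2 * (1 - (n 2 : ℂ)) * hppC
    refine ⟨![p, (n 0 + Complex.I * n 1) / (2 * p)], ?_, ?_⟩
    · simp [dotProduct, Fin.sum_univ_two, ← sub_eq_add_neg]
      rw [map_ofNat, hppC, hq]
      ring
    · rw [pauliVec_eq]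
      ext i j
      fin_cases i <;> fin_cases j <;> simp [vecMulVec_apply, ← sub_eq_add_neg]
      · rw [hppC]; ring
      · field_simp
      · field_simp
      · linear_combination -hq

/-- Measuring along `±n` and preparing `x` or `y` sends `w` to `½(1 + n · w) x + ½(1 - n · w) y`. -/
lemma isCQ_blochMap {n x y : Fin 3 → ℝ} (hn : n ⬝ᵥ n = 1) (hx : x ∈ blochBall)
    (hy : y ∈ blochBall) :
    IsCQ (blochMap ((1 / 2 : ℝ) • (x + y)) (vecMulVec ((1 / 2 : ℝ) • (x - y)) n)) := by
  have hn' : -n ⬝ᵥ -n = 1 := by simpa using hn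
  have hnb : n ∈ blochBall := hn.le
  have hnb' : -n ∈ blochBall := hn'.le
  refine ⟨2, ![(1 / 2 : ℂ) • ((1 : M₂) + pauliVec x), (1 / 2 : ℂ) • ((1 : M₂) + pauliVec y)],
    ![(1 / 2 : ℂ) • ((1 : M₂) + pauliVec n), (1 / 2 : ℂ) • ((1 : M₂) + pauliVec (-n))],
    ?_, ⟨?_, ?_⟩, ?_, ?_⟩
  · exact Fin.forall_fin_two.mpr
      ⟨isDensity_of_mem_blochBall hx, isDensity_of_mem_blochBall hy⟩
  · exact Fin.forall_fin_two.mpr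
      ⟨(isDensity_of_mem_blochBall hnb).1, (isDensity_of_mem_blochBall hnb').1⟩
  · simp only [Fin.sum_univ_two, pauliVec_neg, cons_val_zero, cons_val_one]
    module
  · exact Fin.forall_fin_two.mpr
      ⟨isRankOneProjection_of_unit hn, isRankOneProjection_of_unit hn'⟩
  · intro ρ
    have hz : (pauliVec n * ρ).trace = ∑ l, (n l : ℂ) * (pauli l * ρ).trace := by
      simp [pauliVec, Finset.sum_mul, Matrix.trace_sum]
    have hcol : ∀ l, pauliVec (fun k => vecMulVec ((1 / 2 : ℝ) • (x - y)) n k l) =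
        (n l : ℂ) • ((1 / 2 : ℝ) : ℂ) • (pauliVec x - pauliVec y) := by
      intro l
      rw [← pauliVec_sub, ← pauliVec_smul, ← pauliVec_smul]
      congr 1
      ext k
      simp [vecMulVec_apply]
      ring
    simp only [blochMap_apply, hcol, Fin.sum_univ_two, pauliVec_neg, cons_val_zero, cons_val_one,
      Matrix.smul_mul, Matrix.add_mul, Matrix.trace_smul, Matrix.trace_add, Matrix.neg_mul,
      Matrix.trace_neg, one_mul, pauliVec_smul, pauliVec_add]
    have hz' : ∑ l, (pauli l * ρ).trace •
        ((n l : ℂ) • ((1 / 2 : ℝ) : ℂ) • (pauliVec x - pauliVec y)) =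
        (pauliVec n * ρ).trace • ((1 / 2 : ℝ) : ℂ) • (pauliVec x - pauliVec y) := by
      rw [hz, Finset.sum_smul]
      refine Finset.sum_congr rfl fun l _ => ?_
      simp only [smul_smul]
      congr 1
      ring
    rw [hz']
    push_cast
    simp only [smul_eq_mul]
    module

lemma blochMap_combo (t t' : Fin 3 → ℝ) (T T' : Matrix (Fin 3) (Fin 3) ℝ) {a b : ℝ}
    (hab : a + b = 1) :
    blochMap (a • t + b • t') (a • T + b • T') = a • blochMap t T + b • blochMap t' T' := by
  refine ext_pauli ?_ fun k => ?_
  · rw [LinearMap.add_apply, LinearMap.smul_apply, LinearMap.smul_apply]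
    simp only [blochMap_one, ← Complex.coe_smul, pauliVec_add, pauliVec_smul]
    obtain rfl : b = 1 - a := by linarith
    push_cast
    module
  · rw [LinearMap.add_apply, LinearMap.smul_apply, LinearMap.smul_apply, ← pauliVec_single]
    simp only [blochMap_pauliVec, ← Complex.coe_smul]
    rw [← pauliVec_smul, ← pauliVec_smul, ← pauliVec_add, add_mulVec, smul_mulVec, smul_mulVec]

lemma exists_unit_smul {n : Fin 3 → ℝ} (hn : n ∈ blochBall) :
    ∃ (m : Fin 3 → ℝ) (r : ℝ), m ⬝ᵥ m = 1 ∧ 0 ≤ r ∧ r ≤ 1 ∧ n = r • m := by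
  by_cases h : n = 0
  · exact ⟨Pi.single 0 1, 0, by simp, le_rfl, zero_le_one, by simp [h]⟩
  · have hpos : 0 < n ⬝ᵥ n := lt_of_le_of_ne
      (Finset.sum_nonneg fun i _ => mul_self_nonneg (n i))
      fun h' => h (dotProduct_self_eq_zero.mp h'.symm)
    have hs := Real.sqrt_pos.mpr hpos
    refine ⟨(√(n ⬝ᵥ n))⁻¹ • n, √(n ⬝ᵥ n), ?_, hs.le, Real.sqrt_le_one.mpr hn, ?_⟩
    · rw [smul_dotProduct, dotProduct_smul, smul_eq_mul, smul_eq_mul, ← mul_assoc, ← mul_inv,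
        Real.mul_self_sqrt hpos.le, inv_mul_cancel₀ hpos.ne']
    · rw [smul_smul, mul_inv_cancel₀ hs.ne', one_smul]

/-- For `n = r m` with `m` a unit vector, the map is the mixture of the CQ maps along `m` and `-m`
with weights `(1 ± r) / 2`. -/
lemma blochMap_mem_convexHull {n x y : Fin 3 → ℝ} (hn : n ∈ blochBall) (hx : x ∈ blochBall)
    (hy : y ∈ blochBall) :
    blochMap ((1 / 2 : ℝ) • (x + y)) (vecMulVec ((1 / 2 : ℝ) • (x - y)) n) ∈
      convexHull ℝ {Ψ : M₂ →ₗ[ℂ] M₂ | IsCQ Ψ} := by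
  obtain ⟨m, r, hm, hr0, hr1, rfl⟩ := exists_unit_smul hn
  have h1 := subset_convexHull ℝ {Ψ : M₂ →ₗ[ℂ] M₂ | IsCQ Ψ} (isCQ_blochMap hm hx hy)
  have h2 := subset_convexHull ℝ {Ψ : M₂ →ₗ[ℂ] M₂ | IsCQ Ψ}
    (isCQ_blochMap (n := -m) (by simpa using hm) hx hy)
  have hab : (1 + r) / 2 + (1 - r) / 2 = 1 := by ring
  have := convex_convexHull ℝ _ h1 h2 (by linarith : 0 ≤ (1 + r) / 2)
    (by linarith : 0 ≤ (1 - r) / 2) hab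
  rw [← blochMap_combo _ _ _ _ hab] at this
  convert this using 2
  · rw [← add_smul, hab, one_smul]
  · ext i j
    simp [vecMulVec_apply]
    ring

/-! ### Entanglement witnesses from separating functionals -/

/-- The witness map sending `I` to `u - c · σ` and `σₗ` to `hₗ - ∑ₖ Mₖₗ σₖ`. -/
def witness (u : ℝ) (c h : Fin 3 → ℝ) (M : Matrix (Fin 3) (Fin 3) ℝ) : M₂ →ₗ[ℂ] M₂ where
  toFun ρ := (1 / 2 : ℂ) • (ρ.trace • ((u : ℂ) • 1 - pauliVec c) +
    ∑ l, (pauli l * ρ).trace • ((h l : ℂ) • 1 - pauliVec (fun k => M k l)))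
  map_add' ρ ρ' := by
    simp only [Matrix.mul_add, Matrix.trace_add, Fin.sum_univ_three]
    module
  map_smul' c ρ := by
    simp only [Matrix.mul_smul, Matrix.trace_smul, Fin.sum_univ_three, smul_eq_mul,
      RingHom.id_apply]
    module

lemma witness_apply (u : ℝ) (c h : Fin 3 → ℝ) (M : Matrix (Fin 3) (Fin 3) ℝ) (ρ : M₂) :
    witness u c h M ρ = (1 / 2 : ℂ) • (ρ.trace • ((u : ℂ) • 1 - pauliVec c) +
      ∑ l, (pauli l * ρ).trace • ((h l : ℂ) • 1 - pauliVec (fun k => M k l))) := rfl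

lemma witness_one (u : ℝ) (c h : Fin 3 → ℝ) (M : Matrix (Fin 3) (Fin 3) ℝ) :
    witness u c h M 1 = (u : ℂ) • 1 - pauliVec c := by
  simp [witness_apply, smul_smul]

lemma witness_pauliVec (u : ℝ) (c h : Fin 3 → ℝ) (M : Matrix (Fin 3) (Fin 3) ℝ)
    (v : Fin 3 → ℝ) :
    witness u c h M (pauliVec v) = ((h ⬝ᵥ v : ℝ) : ℂ) • 1 - pauliVec (M *ᵥ v) := by
  have h1 := blochMap_pauliVec 0 M v
  rw [blochMap_apply] at h1
  have e : ∑ l, 2 * (v l : ℂ) * h l = 2 * ((h ⬝ᵥ v : ℝ) : ℂ) := by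
    simp only [dotProduct, Complex.ofReal_sum, Complex.ofReal_mul, Finset.mul_sum]
    refine Finset.sum_congr rfl fun k _ => ?_
    ring
  rw [← h1, witness_apply]
  simp only [trace_pauliVec, zero_smul, zero_add, trace_pauli_mul_pauliVec, smul_sub,
    Finset.sum_sub_distrib, smul_smul, ← Finset.sum_smul, e]
  module

/-- The parameter `h` drops out because the images of the Pauli matrices under `blochMap` are
traceless; this leaves it free to be chosen later. -/
lemma pairing_witness_blochMap (u : ℝ) (c h t : Fin 3 → ℝ) (M T : Matrix (Fin 3) (Fin 3) ℝ) :
    pairing (witness u c h M) (blochMap t T) =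
      2 * ((u - c ⬝ᵥ t - ∑ l, (fun k => M k l) ⬝ᵥ (fun k => T k l) : ℝ) : ℂ) := by
  have h1 : ∀ (a : ℂ) (v w : Fin 3 → ℝ), ((a • (1 : M₂) - pauliVec v) * pauliVec w).trace =
      -(2 * ((v ⬝ᵥ w : ℝ) : ℂ)) := by
    intro a v w
    simp [Matrix.sub_mul, trace_pauliVec_mul]
  have h2 : ∀ l, witness u c h M (pauli l) = (h l : ℂ) • 1 - pauliVec (fun k => M k l) := by
    intro l
    rw [← pauliVec_single, witness_pauliVec]
    congr 2
    · simp
    · ext k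
      simp
  simp only [pairing, witness_one, blochMap_one, h2, blochMap_pauli, h1, Matrix.mul_add,
    Matrix.trace_add, mul_one, Matrix.trace_sub, Matrix.trace_smul, trace_pauliVec,
    Matrix.trace_one]
  simp [mul_sub, Finset.mul_sum]
  ring

lemma dotProduct_self_nonneg (v : Fin 3 → ℝ) : 0 ≤ v ⬝ᵥ v :=
  Finset.sum_nonneg fun i _ => mul_self_nonneg (v i)

lemma exists_mem_blochBall_dotProduct_eq (v : Fin 3 → ℝ) :
    ∃ x ∈ blochBall, x ⬝ᵥ v = √(v ⬝ᵥ v) := by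
  obtain h0 | hpos := (dotProduct_self_nonneg v).eq_or_lt
  · exact ⟨0, by simp [blochBall], by simp [← h0]⟩
  · have hs := Real.sqrt_pos.mpr hpos
    have e := Real.mul_self_sqrt hpos.le
    refine ⟨(√(v ⬝ᵥ v))⁻¹ • v, show _ ≤ (1 : ℝ) from le_of_eq ?_, ?_⟩
    · rw [smul_dotProduct, dotProduct_smul, smul_eq_mul, smul_eq_mul, ← mul_assoc, ← mul_inv,
        e, inv_mul_cancel₀ hpos.ne']
    · rw [smul_dotProduct, smul_eq_mul, inv_mul_eq_iff_eq_mul₀ hs.ne', e]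

/-- If `|p + q| + |p - q| ≤ 2u`, then `u + p · q / u ≥ |p + q|`. -/
lemma sqrt_add_le_of_forall_blochBall {u : ℝ} (hu : 0 < u) {p q : Fin 3 → ℝ}
    (h : ∀ x ∈ blochBall, ∀ y ∈ blochBall, x ⬝ᵥ (p + q) + y ⬝ᵥ (p - q) ≤ 2 * u) :
    √((p + q) ⬝ᵥ (p + q)) ≤ u + p ⬝ᵥ q / u := by
  obtain ⟨x, hx, hx'⟩ := exists_mem_blochBall_dotProduct_eq (p + q)
  obtain ⟨y, hy, hy'⟩ := exists_mem_blochBall_dotProduct_eq (p - q)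
  have hle := h x hx y hy
  rw [hx', hy'] at hle
  have e1 := Real.mul_self_sqrt (dotProduct_self_nonneg (p + q))
  have e2 := Real.mul_self_sqrt (dotProduct_self_nonneg (p - q))
  have n2 := Real.sqrt_nonneg ((p - q) ⬝ᵥ (p - q))
  have e3 : (p + q) ⬝ᵥ (p + q) - (p - q) ⬝ᵥ (p - q) = 4 * p ⬝ᵥ q := by
    simp [dotProduct, Fin.sum_univ_three]
    ring
  set a := √((p + q) ⬝ᵥ (p + q))
  set b := √((p - q) ⬝ᵥ (p - q))
  -- Square `b ≤ 2u - a` and substitute `a² - b² = 4 p · q`.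
  have key : a * u ≤ u * u + p ⬝ᵥ q := by nlinarith
  rw [← sub_nonneg] at key ⊢
  have : u + p ⬝ᵥ q / u - a = (u * u + p ⬝ᵥ q - a * u) / u := by
    field_simp
  rw [this]
  positivity

/-- On `a (1 + n · σ)` the value is `a` times `(u + c · M n / u) - (c + M n) · σ`, so positivity is
exactly the bound of `sqrt_add_le_of_forall_blochBall`. -/
lemma isPositiveMap_witness {u : ℝ} (hu : 0 < u) {c : Fin 3 → ℝ} {M : Matrix (Fin 3) (Fin 3) ℝ}
    (h : ∀ n ∈ blochBall, ∀ x ∈ blochBall, ∀ y ∈ blochBall,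
      x ⬝ᵥ (c + M *ᵥ n) + y ⬝ᵥ (c - M *ᵥ n) ≤ 2 * u) :
    IsPositiveMap (witness u c (u⁻¹ • (c ᵥ* M)) M) := by
  intro ρ hρ
  obtain ⟨a, v, rfl⟩ := exists_eq_of_isHermitian hρ.1
  obtain ⟨ha, hv⟩ := (posSemidef_iff a v).mp hρ
  obtain rfl | ha := ha.eq_or_lt
  · have : v = 0 := by
      apply dotProduct_self_eq_zero.mp
      exact le_antisymm (by simpa using hv) (dotProduct_self_nonneg v)
    simp [this, Matrix.PosSemidef.zero]
  · have hn : a⁻¹ • v ∈ blochBall := by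
      simp only [blochBall, Set.mem_ofPred_eq, smul_dotProduct, dotProduct_smul, smul_eq_mul]
      rw [← mul_assoc, ← mul_inv, inv_mul_le_iff₀ (by positivity)]
      nlinarith
    have key := sqrt_add_le_of_forall_blochBall hu (h _ hn)
    have hva : v = a • a⁻¹ • v := by rw [smul_smul, mul_inv_cancel₀ ha.ne', one_smul]
    set n := a⁻¹ • v
    have e : witness u c (u⁻¹ • (c ᵥ* M)) M ((a : ℂ) • 1 + pauliVec v) =
        (a : ℂ) • (((u + c ⬝ᵥ (M *ᵥ n) / u : ℝ) : ℂ) • 1 + pauliVec (-(c + M *ᵥ n))) := by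
      rw [hva, map_add, map_smul, witness_one, pauliVec_smul, map_smul, witness_pauliVec,
        pauliVec_neg, pauliVec_add, smul_dotProduct, dotProduct_mulVec, smul_eq_mul, div_eq_inv_mul]
      push_cast
      module
    rw [e]
    refine Matrix.PosSemidef.smul ((posSemidef_iff _ _).mpr ⟨?_, ?_⟩) (by exact_mod_cast ha.le)
    · exact (Real.sqrt_nonneg _).trans key
    · rw [neg_dotProduct_neg]
      exact (Real.sqrt_le_left ((Real.sqrt_nonneg _).trans key)).mp key

/-- The left factor is a multiple of the inverse of the image of `1` when `u² ≠ c · c`. The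
condition on `h` is what removes the Pauli components of `ρ` from the trace. -/
lemma trace_mul_witness (u : ℝ) (c h : Fin 3 → ℝ) (M : Matrix (Fin 3) (Fin 3) ℝ)
    (hh : u • h = c ᵥ* M) (ρ : M₂) :
    (((u : ℂ) • 1 + pauliVec c) * witness u c h M ρ).trace =
      ((u ^ 2 - c ⬝ᵥ c : ℝ) : ℂ) * ρ.trace := by
  have h1 : ∀ (a : ℝ) (v : Fin 3 → ℝ),
      (((u : ℂ) • 1 + pauliVec c) * ((a : ℂ) • (1 : M₂) - pauliVec v)).trace =
      2 * ((u * a - c ⬝ᵥ v : ℝ) : ℂ) := by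
    intro a v
    simp [Matrix.add_mul, Matrix.mul_sub, trace_pauliVec_mul]
    ring
  have h2 : ∀ l, u * h l - c ⬝ᵥ (fun k => M k l) = 0 := by
    intro l
    have := congrFun hh l
    simp only [Pi.smul_apply, smul_eq_mul] at this
    rw [this]
    exact sub_self _
  rw [witness_apply, Matrix.mul_smul, Matrix.mul_add, Matrix.mul_sum]
  simp only [Matrix.mul_smul, Matrix.trace_smul, Matrix.trace_add, Matrix.trace_sum, h1, h2]
  simp
  ring

lemma le_of_forall_blochBall {Φ : M₂ →ₗ[ℂ] M₂} (hΦ : IsCP Φ) (hΦ' : IsCP (Φ ∘ₗ transposeMap))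
    {t : Fin 3 → ℝ} {T : Matrix (Fin 3) (Fin 3) ℝ} (hΦt : Φ = blochMap t T) {u : ℝ}
    {c : Fin 3 → ℝ} {M : Matrix (Fin 3) (Fin 3) ℝ}
    (h : ∀ n ∈ blochBall, ∀ x ∈ blochBall, ∀ y ∈ blochBall,
      x ⬝ᵥ (c + M *ᵥ n) + y ⬝ᵥ (c - M *ᵥ n) < 2 * u) :
    c ⬝ᵥ t + ∑ l, (fun k => M k l) ⬝ᵥ (fun k => T k l) ≤ u := by
  have h0 : (0 : Fin 3 → ℝ) ∈ blochBall := by simp [blochBall]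
  have hu : 0 < u := by
    have := h 0 h0 0 h0 0 h0
    simp at this
    exact this
  -- Taking `n = 0` and `x = y` along `c` gives `|c| < u`; strictness makes `W 1` invertible.
  have hcu : 0 < u ^ 2 - c ⬝ᵥ c := by
    obtain ⟨x, hx, hx'⟩ := exists_mem_blochBall_dotProduct_eq c
    have h1 := h 0 h0 x hx x hx
    simp only [mulVec_zero, add_zero, sub_zero, hx'] at h1
    have e := Real.mul_self_sqrt (dotProduct_self_nonneg c)
    have hs := Real.sqrt_nonneg (c ⬝ᵥ c)
    nlinarith
  set W := witness u c (u⁻¹ • (c ᵥ* M)) M with hW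
  have hWpos : IsPositiveMap W :=
    isPositiveMap_witness hu fun n hn x hx y hy => (h n hn x hx y hy).le
  have hY : (W 1).PosSemidef := hWpos 1 .one
  obtain ⟨B, hB⟩ : ∃ B : M₂, W 1 = Bᴴ * B := by
    open scoped MatrixOrder in
    exact CStarAlgebra.nonneg_iff_eq_star_mul_self.mp hY.nonneg
  have hinv : ((u : ℂ) • 1 + pauliVec c) * W 1 = ((u ^ 2 - c ⬝ᵥ c : ℝ) : ℂ) • 1 := by
    rw [hW, witness_one, Matrix.add_mul, Matrix.mul_sub, Matrix.mul_sub, pauliVec_mul]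
    simp only [Matrix.smul_mul, Matrix.mul_smul, one_mul, mul_one, cross_self, pauliVec_zero]
    push_cast
    module
  have hcuC : ((u ^ 2 - c ⬝ᵥ c : ℝ) : ℂ) ≠ 0 := by exact_mod_cast hcu.ne'
  set δ : ℂ := ((u ^ 2 - c ⬝ᵥ c : ℝ) : ℂ) with hδ
  set Z : M₂ := δ⁻¹ • ((u : ℂ) • 1 + pauliVec c) with hZ
  have hZW : Z * (Bᴴ * B) = 1 := by
    rw [← hB, hZ, Matrix.smul_mul, hinv, smul_smul, inv_mul_cancel₀ hcuC, one_smul]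
  -- `C` is the inverse of `B`, so conjugating `W` by `Cᴴ` normalises it to be unital, and `C * Cᴴ =
  -- Z` makes it trace preserving.
  set C : M₂ := Z * Bᴴ with hC
  have hCB : C * B = 1 := by rw [hC, Matrix.mul_assoc, hZW]
  have hBC : B * C = 1 := mul_eq_one_comm.mp hCB
  have hCB' : Bᴴ * Cᴴ = 1 := by rw [← conjTranspose_mul, hCB, conjTranspose_one]
  have hBC' : Cᴴ * Bᴴ = 1 := by rw [← conjTranspose_mul, hBC, conjTranspose_one]
  have hCC : C * Cᴴ = Z := by rw [hC, Matrix.mul_assoc, hCB', mul_one]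
  have hdecomp : conjMap Bᴴ ∘ₗ conjMap Cᴴ ∘ₗ W = W := by
    rw [← LinearMap.comp_assoc, conjMap_comp, hCB', conjMap_one, LinearMap.id_comp]
  have hpos : IsPositiveMap (conjMap Cᴴ ∘ₗ W) := fun ρ hρ =>
    isPositiveMap_conjMap Cᴴ _ (hWpos ρ hρ)
  have hone : (conjMap Cᴴ ∘ₗ W) 1 = 1 := by
    rw [LinearMap.comp_apply, conjMap_apply, hB, conjTranspose_conjTranspose,
      ← Matrix.mul_assoc Cᴴ, hBC', one_mul, hBC]
  have hTP : IsTracePreserving (conjMap Cᴴ ∘ₗ W) := by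
    intro ρ
    rw [LinearMap.comp_apply, conjMap_apply, conjTranspose_conjTranspose, Matrix.trace_mul_comm,
      ← Matrix.mul_assoc, hCC, hZ, Matrix.smul_mul, Matrix.trace_smul, hW, trace_mul_witness,
      smul_eq_mul, ← mul_assoc, inv_mul_cancel₀ hcuC, one_mul]
    rw [smul_smul, mul_inv_cancel₀ hu.ne', one_smul]
  have hfin := pairing_nonneg_of_unital hΦ hΦ' hpos hTP hone Bᴴ
  rw [hdecomp, hΦt, hW, pairing_witness_blochMap] at hfin
  have h2 : (2 : ℂ) = ((2 : ℝ) : ℂ) := by simp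
  rw [h2, ← Complex.ofReal_mul, Complex.ofReal_re] at hfin
  linarith

/-! ### Hahn–Banach separation from the CQ parameters -/

lemma exists_dotProduct_repr (f : (Fin 3 → ℝ) × (Fin 3 → Fin 3 → ℝ) →ₗ[ℝ] ℝ) :
    ∃ (c : Fin 3 → ℝ) (M : Matrix (Fin 3) (Fin 3) ℝ), ∀ (v : Fin 3 → ℝ)
      (A : Matrix (Fin 3) (Fin 3) ℝ),
        f (v, fun k l => A k l) = c ⬝ᵥ v + ∑ l, (fun k => M k l) ⬝ᵥ (fun k => A k l) := by
  refine ⟨fun k => f (Pi.single k 1, 0),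
    Matrix.of fun k l => f (0, Pi.single k (Pi.single l 1)), fun v A => ?_⟩
  have hv : v = ∑ k, v k • (Pi.single k 1 : Fin 3 → ℝ) := by
    ext j
    simp [Finset.sum_apply, Pi.single_apply]
  have hA : (fun k l => A k l) =
      ∑ k, ∑ l, A k l • (Pi.single k (Pi.single l 1) : Fin 3 → Fin 3 → ℝ) := by
    ext i j
    fin_cases i <;> fin_cases j <;> simp [Fin.sum_univ_three]
  have e : (v, fun k l => A k l) =
      ∑ k, v k • ((Pi.single k 1 : Fin 3 → ℝ), (0 : Fin 3 → Fin 3 → ℝ)) +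
        ∑ k, ∑ l, A k l •
          ((0 : Fin 3 → ℝ), (Pi.single k (Pi.single l 1) : Fin 3 → Fin 3 → ℝ)) := by
    refine Prod.ext ?_ ?_
    · simpa [Prod.fst_sum] using hv
    · simpa [Prod.snd_sum] using hA
  rw [e, Finset.sum_comm (γ := Fin 3)]
  simp only [map_add, map_sum, map_smul, smul_eq_mul, dotProduct, Matrix.of_apply, mul_comm]

/-- The parameters `(t, T)` of classical-quantum maps, with the projective measurement replaced by
an unsharp one. -/
def cqParams : Set ((Fin 3 → ℝ) × (Fin 3 → Fin 3 → ℝ)) :=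
  (fun p : (Fin 3 → ℝ) × (Fin 3 → ℝ) × (Fin 3 → ℝ) =>
    ((1 / 2 : ℝ) • (p.2.1 + p.2.2), fun k l => (1 / 2 : ℝ) * (p.2.1 k - p.2.2 k) * p.1 l)) ''
  (blochBall ×ˢ blochBall ×ˢ blochBall)

lemma isCompact_cqParams : IsCompact cqParams :=
  (isCompact_blochBall.prod (isCompact_blochBall.prod isCompact_blochBall)).image (by fun_prop)

lemma blochMap_mem_convexHull_of_mem {t : Fin 3 → ℝ} {T : Matrix (Fin 3) (Fin 3) ℝ}
    (h : (t, fun k l => T k l) ∈ convexHull ℝ cqParams) :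
    blochMap t T ∈ convexHull ℝ {Ψ : M₂ →ₗ[ℂ] M₂ | IsCQ Ψ} := by
  have hconv : Convex ℝ {p : (Fin 3 → ℝ) × (Fin 3 → Fin 3 → ℝ) |
      blochMap p.1 (Matrix.of p.2) ∈ convexHull ℝ {Ψ : M₂ →ₗ[ℂ] M₂ | IsCQ Ψ}} := by
    intro p hp q hq a b ha hb hab
    rw [Set.mem_ofPred_eq] at hp hq ⊢
    have h1 := convex_convexHull ℝ _ hp hq ha hb hab
    rw [← blochMap_combo _ _ _ _ hab] at h1
    exact h1
  have hsub : cqParams ⊆ {p : (Fin 3 → ℝ) × (Fin 3 → Fin 3 → ℝ) |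
      blochMap p.1 (Matrix.of p.2) ∈ convexHull ℝ {Ψ : M₂ →ₗ[ℂ] M₂ | IsCQ Ψ}} := by
    rintro _ ⟨⟨n, x, y⟩, ⟨hn, hx, hy⟩, rfl⟩
    have e : vecMulVec ((1 / 2 : ℝ) • (x - y)) n =
        Matrix.of fun k l => (1 / 2 : ℝ) * (x k - y k) * n l := by
      ext k l
      simp [vecMulVec_apply]
    have h1 := blochMap_mem_convexHull hn hx hy
    rw [e] at h1
    rw [Set.mem_ofPred_eq]
    exact h1
  have h2 := convexHull_min hsub hconv h
  rw [Set.mem_ofPred_eq] at h2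
  exact h2

lemma dotProduct_cqParams (c n x y : Fin 3 → ℝ) (M : Matrix (Fin 3) (Fin 3) ℝ) :
    x ⬝ᵥ (c + M *ᵥ n) + y ⬝ᵥ (c - M *ᵥ n) = 2 * (c ⬝ᵥ ((1 / 2 : ℝ) • (x + y)) +
      ∑ l, (fun k => M k l) ⬝ᵥ (fun k => (1 / 2 : ℝ) * (x k - y k) * n l)) := by
  simp [dotProduct, Fin.sum_univ_three, mulVec]
  ring

/-- A separating functional would be strictly below `u` on all CQ parameters and strictly above `u`
at `(t, T)`, which `le_of_forall_blochBall` excludes. -/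
lemma mem_convexHull_cqParams {t : Fin 3 → ℝ} {T : Matrix (Fin 3) (Fin 3) ℝ}
    (hΦ : IsCP (blochMap t T)) (hΦ' : IsCP (blochMap t T ∘ₗ transposeMap)) :
    (t, fun k l => T k l) ∈ convexHull ℝ cqParams := by
  by_contra hcon
  obtain ⟨f, u, hf, hfu⟩ := geometric_hahn_banach_closed_point (convex_convexHull ℝ cqParams)
    (isCompact_convexHull_of_finiteDimensional isCompact_cqParams).isClosed hcon
  obtain ⟨c, M, hfeq⟩ := exists_dotProduct_repr f.toLinearMap
  refine absurd (le_of_forall_blochBall hΦ hΦ' rfl (u := u) (c := c) (M := M) ?_) ?_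
  · intro n hn x hx y hy
    have h1 := hf _ (subset_convexHull ℝ cqParams ⟨(n, x, y), ⟨hn, hx, hy⟩, rfl⟩)
    have h2 := hfeq ((1 / 2 : ℝ) • (x + y)) (Matrix.of fun k l => (1 / 2 : ℝ) * (x k - y k) * n l)
    have h3 := h2.symm.trans_lt h1
    rw [dotProduct_cqParams]
    exact mul_lt_mul_of_pos_left h3 two_pos
  · rw [not_le, ← hfeq]
    exact hfu

lemma mem_convexHull_of_isCP {Φ : M₂ →ₗ[ℂ] M₂} (hTP : IsTracePreserving Φ) (hΦ : IsCP Φ)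
    (hΦ' : IsCP (Φ ∘ₗ transposeMap)) : Φ ∈ convexHull ℝ {Ψ : M₂ →ₗ[ℂ] M₂ | IsCQ Ψ} := by
  obtain ⟨t, T, rfl⟩ := hΦ.isPositiveMap.exists_eq_blochMap hTP
  exact blochMap_mem_convexHull_of_mem (mem_convexHull_cqParams hΦ hΦ')

end QubitMap

end

theorem mainTheorem2 (Φ : QubitMap.M₂ →ₗ[ℂ] QubitMap.M₂)
    (hTP : QubitMap.IsTracePreserving Φ) :
    List.TFAE [
      -- (A) Holevo form with a POVM
      QubitMap.HasHolevoForm Φ,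
      -- (B) entanglement breaking
      QubitMap.IsEntanglementBreaking Φ,
      -- (C) composition with the transpose
      QubitMap.IsCP Φ ∧ QubitMap.IsCP (Φ ∘ₗ QubitMap.transposeMap),
      -- (D) sign changes, in every canonical form
      QubitMap.IsCP Φ ∧ ∀ t lam : Fin 3 → ℝ,
        QubitMap.IsCanonicalForm Φ t lam → QubitMap.SignChangesCP t lam,
      -- (D) sign changes, in some canonical form
      QubitMap.IsCP Φ ∧ ∃ t lam : Fin 3 → ℝ,
        QubitMap.IsCanonicalForm Φ t lam ∧ QubitMap.SignChangesCP t lam,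
      -- (E) convex hull of CQ maps
      Φ ∈ convexHull ℝ {Ψ : QubitMap.M₂ →ₗ[ℂ] QubitMap.M₂ | QubitMap.IsCQ Ψ}] := by
  tfae_have 1 → 2 := fun h => h.isEntanglementBreaking
  tfae_have 2 → 3 := fun h => h.isCP
  tfae_have 3 → 6 := fun h => QubitMap.mem_convexHull_of_isCP hTP h.1 h.2
  tfae_have 6 → 1 := QubitMap.hasHolevoForm_of_mem_convexHull
  tfae_have 3 → 4 := fun h => ⟨h.1, fun _ _ hc => hc.isCP_comp_transposeMap_iff.mp h.2⟩
  tfae_have 4 → 5 := by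
    rintro ⟨hCP, h⟩
    -- The condition over all canonical forms could be vacuous, so one has to be produced.
    obtain ⟨t, T, hΦ⟩ := hCP.isPositiveMap.exists_eq_blochMap hTP
    obtain ⟨t', lam, hc⟩ := QubitMap.exists_isCanonicalForm_blochMap t T
    rw [← hΦ] at hc
    exact ⟨hCP, t', lam, hc, h t' lam hc⟩
  tfae_have 5 → 3 := by
    rintro ⟨hCP, t, lam, hc, h⟩
    exact ⟨hCP, hc.isCP_comp_transposeMap_iff.mpr h⟩
  tfae_finish
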